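/- Theorem (Strong consistency of the CTLS solution with row and column constraints). Let $j,k,\ell\ge 0$ and $n\ge k$ be fixed integers. For $m\ge j$ consider the model $$\begin{bmatrix}0_{j\times k}&\bar A_{12}\\ \bar A_{21}&\bar A_{22}\end{bmatrix}X=\begin{bmatrix}\bar B_1\\ \bar B_2\end{bmatrix},\qquad X\in\mathbb R^{n\times\ell},$$ where $\bar A_{12}\in\mathbb R^{j\times(n-k)}$, $\bar B_1\in\mathbb R^{j\times\ell}$ and $X$ do not depend on $m$, and the $m-j$ rows of $\bar A_{21}\in\mathbb R^{(m-j)\times k}$, $\bar A_{22}\in\mathbb R^{(m-j)\times(n-k)}$, $\bar B_2\in\mathbb R^{(m-j)\times\ell}$ are the first $m-j$ terms of fixed infinite sequences of row vectors. The observed data are $A_{12}=\bar A_{12}$, $A_{21}=\bar A_{21}$, $B_1=\bar B_1$, $A_{22}=\bar A_{22}+E_{A_{22}}$, $B_2=\bar B_2+E_{B_2}$. Put $C_{21}=\bar C_{21}=\bar A_{21}$, $\bar C_{12}=[\bar A_{12}\ \bar B_1]$, $\bar C_{22}=[\bar A_{22}\ \bar B_2]$, $C_{22}=[A_{22}\ B_2]$,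 $E=[E_{A_{22}}\ E_{B_2}]$, $$G=C_{22}^\top C_{22}-C_{22}^\top C_{21}(C_{21}^\top C_{21})^{-1}C_{21}^\top C_{22},$$ and let $\bar G$ be the same expression in $\bar C_{21},\bar C_{22}$. Assume $\operatorname{rank}\bar C_{12}=j$ (which forces $j\le n-k$), and let $\widetilde P\in\mathbb R^{(n+\ell-k)\times(n+\ell-k-j)}$ satisfy $\widetilde P^\top\widetilde P=I$ and $\bar C_{12}\widetilde P=0$. Assume further: * the rows of $E$ are the first $m-j$ terms of a sequence of i.i.d. random vectors on a probability space, with mean $0$ and covariance matrix $\sigma^2I$; * $\lim_{m\to\infty}m^{-1}\bar C_{21}^\top[\bar C_{21}\ \bar C_{22}]$ exists, $\lim_{m\to\infty}m^{-1}\bar C_{21}^\top\bar C_{21}$ is positive definite, and $\bar T=\lim_{m\to\infty}m^{-1}\widetilde P^\top\bar G\widetilde P$ exists and has rank $n-j-k$. A CTLS solution $X_{\rm ctls}\in\mathbb R^{n\times\ell}$ (for given $m$) is a matrix that, together with some $\Delta A,\Delta B$, minimizes $\|\Delta A\|_F^2+\|\Delta B\|_F^2$ subject to $$\begin{bmatrix}0_{j\times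 k}&A_{12}\\ A_{21}&A_{22}+\Delta A\end{bmatrix}X_{\rm ctls}=\begin{bmatrix}B_1\\ B_2+\Delta B\end{bmatrix}.$$ Then, with probability one: 1. for all sufficiently large $m$ there is exactly one CTLS solution $X_{\rm ctls}$; 2. for all sufficiently large $m$, its lower $(n-k)\times\ell$ part is $\widetilde X_{\rm ctls}=-\widetilde Z_{\rm upper}\widetilde Z_{\rm lower}^{-1}$ for every matrix $\widetilde Z=\begin{bmatrix}\widetilde Z_{\rm upper}\\ \widetilde Z_{\rm lower}\end{bmatrix}$ (blocks with $n-k$ and $\ell$ rows) whose columns are orthonormal Ritz vectors of $G$ on $\operatorname{range}(\widetilde P)$ for the $\ell$ smallest Ritz values, $\widetilde Z_{\rm lower}$ being nonsingular, and its upper $k\times\ell$ part is determined by $[\,C_{21}^\top C_{21}\ \ C_{21}^\top C_{22}\,]\begin{bmatrix}X_{\rm ctls}\\ -I\end{bmatrix}=0_{k\times\ell}$, with $C_{21}^\top C_{21}$ nonsingular; 3. $\lim_{m\to\infty}X_{\rm ctls}=X$. -/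

import Mathlib

open Matrix Filter Topology MeasureTheory ProbabilityTheory

noncomputable section

namespace CTLS

/-- The matrix whose rows are the first `N` vectors of the sequence `a`. -/
def firstRows {κ : Type*} (N : ℕ) (a : ℕ → κ → ℝ) : Matrix (Fin N) κ ℝ :=
  Matrix.of fun i c => a i c

/-- The squared Frobenius norm. -/
def frobSq {ι κ : Type*} [Fintype ι] [Fintype κ] (M : Matrix ι κ ℝ) : ℝ :=
  ∑ i, ∑ c, M i c ^ 2

/-- The constraint
`[A₁₁ A₁₂; A₂₁ A₂₂ + ΔA] X = [B₁; B₂ + ΔB]`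
of the total least squares problem with fixed rows and fixed columns. -/
def Feasible {ρ ι κ τ lam : Type*} [Fintype κ] [Fintype τ]
    (A₁₁ : Matrix ρ κ ℝ) (A₁₂ : Matrix ρ τ ℝ) (A₂₁ : Matrix ι κ ℝ) (A₂₂ : Matrix ι τ ℝ)
    (B₁ : Matrix ρ lam ℝ) (B₂ : Matrix ι lam ℝ)
    (X : Matrix (κ ⊕ τ) lam ℝ) (ΔA : Matrix ι τ ℝ) (ΔB : Matrix ι lam ℝ) : Prop :=
  fromBlocks A₁₁ A₁₂ A₂₁ (A₂₂ + ΔA) * X = fromRows B₁ (B₂ + ΔB)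

/-- `X` is a solution of the constrained total least squares problem: together with some
`ΔA`, `ΔB` it minimizes `‖ΔA‖_F² + ‖ΔB‖_F²` among all feasible triples `(X, ΔA, ΔB)`. -/
def IsSolution {ρ ι κ τ lam : Type*} [Fintype ι] [Fintype κ] [Fintype τ] [Fintype lam]
    (A₁₁ : Matrix ρ κ ℝ) (A₁₂ : Matrix ρ τ ℝ) (A₂₁ : Matrix ι κ ℝ) (A₂₂ : Matrix ι τ ℝ)
    (B₁ : Matrix ρ lam ℝ) (B₂ : Matrix ι lam ℝ) (X : Matrix (κ ⊕ τ) lam ℝ) : Prop :=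
  ∃ (ΔA : Matrix ι τ ℝ) (ΔB : Matrix ι lam ℝ),
    Feasible A₁₁ A₁₂ A₂₁ A₂₂ B₁ B₂ X ΔA ΔB ∧
    ∀ (X' : Matrix (κ ⊕ τ) lam ℝ) (ΔA' : Matrix ι τ ℝ) (ΔB' : Matrix ι lam ℝ),
      Feasible A₁₁ A₁₂ A₂₁ A₂₂ B₁ B₂ X' ΔA' ΔB' →
        frobSq ΔA + frobSq ΔB ≤ frobSq ΔA' + frobSq ΔB'

/-- `G = C₂₂ᵀ C₂₂ - C₂₂ᵀ C₂₁ (C₂₁ᵀ C₂₁)⁻¹ C₂₁ᵀ C₂₂`. -/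
def gram {ι κ ν : Type*} [Fintype ι] [Fintype κ] [DecidableEq κ]
    (C₂₁ : Matrix ι κ ℝ) (C₂₂ : Matrix ι ν ℝ) : Matrix ν ν ℝ :=
  C₂₂ᵀ * C₂₂ - C₂₂ᵀ * C₂₁ * (C₂₁ᵀ * C₂₁)⁻¹ * (C₂₁ᵀ * C₂₂)

/-- The columns of `Z` are Ritz vectors of the symmetric matrix `G` for its `l` smallest Ritz
values (with multiplicity) on the range of `P`, where the columns of `P` are orthonormal: `W` is
an orthogonal matrix of eigenvectors of `Pᵀ G P`, ordered by increasing eigenvalue `θ`, and `Z`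
consists of the first `l` columns of `P W`. -/
def IsRitzMatrix {ν : Type*} [Fintype ν] {l d : ℕ}
    (G : Matrix ν ν ℝ) (P : Matrix ν (Fin (l + d)) ℝ) (Z : Matrix ν (Fin l) ℝ) : Prop :=
  ∃ (W : Matrix (Fin (l + d)) (Fin (l + d)) ℝ) (θ : Fin (l + d) → ℝ),
    Monotone θ ∧ Wᵀ * W = 1 ∧ (Pᵀ * G * P) * W = W * diagonal θ ∧
    Z = (P * W).submatrix id (Fin.castAdd d)

/-- The error rows `E 0, E 1, …` are independent and identically distributed, with mean zero and
covariance matrix `σ² I`. -/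
structure ErrorAssumption {Ω ν : Type*} [MeasurableSpace Ω] [DecidableEq ν]
    (μ : Measure Ω) (E : ℕ → Ω → ν → ℝ) (σ : ℝ) : Prop where
  measurable : ∀ i, Measurable (E i)
  indep : iIndepFun E μ
  identDistrib : ∀ i, IdentDistrib (E i) (E 0) μ μ
  memLp : ∀ i a, MemLp (fun ω => E i ω a) 2 μ
  mean : ∀ i a, ∫ ω, E i ω a ∂μ = 0
  cov : ∀ i a b, covariance (fun ω => E i ω a) (fun ω => E i ω b) μ
    = (σ ^ 2 • (1 : Matrix ν ν ℝ)) a b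

/-- The asymptotic assumption on the true parameters. For a total number `m` of rows, the blocks
`C₂₁` and `C₂₂` consist of the first `m - j` rows of the sequences `c₂₁` and `c₂₂`; the limits
`m⁻¹ C₂₁ᵀ [C₂₁ C₂₂] → [S₁₁ S₁₂]` and `m⁻¹ Pᵀ G P → T` exist, `S₁₁` is positive definite, and
`T` has rank `r`. -/
def AsymptoticAssumption {κ ν π : Type*} [Fintype κ] [DecidableEq κ] [Fintype ν] [Fintype π]
    (j : ℕ) (c₂₁ : ℕ → κ → ℝ) (c₂₂ : ℕ → ν → ℝ) (P : Matrix ν π ℝ) (r : ℕ) : Prop :=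
  (∃ (S₁₁ : Matrix κ κ ℝ) (S₁₂ : Matrix κ ν ℝ), S₁₁.PosDef ∧
    Tendsto (fun m : ℕ => (m : ℝ)⁻¹ •
      ((firstRows (m - j) c₂₁)ᵀ * fromCols (firstRows (m - j) c₂₁) (firstRows (m - j) c₂₂)))
      atTop (𝓝 (fromCols S₁₁ S₁₂))) ∧
  ∃ T : Matrix π π ℝ, T.rank = r ∧
    Tendsto (fun m : ℕ => (m : ℝ)⁻¹ •
      (Pᵀ * gram (firstRows (m - j) c₂₁) (firstRows (m - j) c₂₂) * P)) atTop (𝓝 T)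

end CTLS

end

/-! For fixed `m`, write `V = [Y; -I]` with `Y` the lower part of a candidate, and `Δ = [ΔA ΔB]`.
Since the upper left block is zero, the upper rows say only that the columns of `V` lie in the null
space of `[A₁₂ B₁]`, which is the range of `P`. For given `V`, `frobSq_correction` splits `‖Δ‖²`
into two removable squares and the trace of `G` against the projection onto the columns of `V`; the
squares vanish for exactly one upper part (the normal equations) and one `Δ`. What remains is to
minimize `tr (Q Pᵀ G P)` over rank-`l` projections `Q` that come from matrices `[Y; -I]`. By Ky
Fan's principle, with its equality case under a spectral gap, the minimizer is the span of the `l`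
lowest Ritz vectors, provided their lower block is nonsingular; normalizing that block to `-I` gives
`Y` (`isSolution_iff`).

Asymptotically, the strong laws give `m⁻¹ Pᵀ G P → T + σ² I`: products of signal and noise average
to zero, and noise with itself gives `σ² I`. The shift changes no eigenvector. The limit `T` is
positive semidefinite of rank `q - j` and kills `Pᵀ [X₂; -I]`, because the exact equations leave no
residual after regression on `A₂₁`. Hence its kernel is `l`-dimensional, is spanned by these
columns, and is separated from the rest of the spectrum. The spectral projections therefore converge
(`tendsto_lowProj`, again by Ky Fan), the gap persists (`eventually_gap`), and the quotient of
blocks, a continuous function of the projection, converges to the lower part of `X`. The upper part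
follows from convergence of the regression coefficients. -/

/-! ### Strong laws of large numbers -/

/-- **Kronecker's lemma** for the weights `1, 2, 3, …`. -/
theorem tendsto_average_of_tendsto_sum_div {x : ℕ → ℝ} {s : ℝ}
    (h : Tendsto (fun n => ∑ i ∈ Finset.range n, x i / (i + 1)) atTop (𝓝 s)) :
    Tendsto (fun n : ℕ => (n : ℝ)⁻¹ * ∑ i ∈ Finset.range n, x i) atTop (𝓝 0) := by
  set S : ℕ → ℝ := fun n => ∑ i ∈ Finset.range n, x i / (i + 1) with hS
  -- Summation by parts: the average of `x` is `S n` minus the Cesàro mean of `S`, and both tend to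
  -- `s`.
  have key : ∀ n : ℕ, ∑ i ∈ Finset.range n, x i = n * S n - ∑ i ∈ Finset.range n, S i := by
    intro n
    induction n with
    | zero => simp
    | succ n ih =>
      have hn : S (n + 1) = S n + x n / (n + 1) := by simp [hS, Finset.sum_range_succ]
      have hx : x n / ((n : ℝ) + 1) * (n + 1) = x n := div_mul_cancel₀ _ (by positivity)
      rw [Finset.sum_range_succ, Finset.sum_range_succ, ih, hn]
      push_cast
      linear_combination -hx
  have hlim := h.sub h.cesaro
  rw [sub_self] at hlim
  refine hlim.congr' ?_
  filter_upwards [eventually_ne_atTop 0] with n hn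
  have : (n : ℝ) ≠ 0 := Nat.cast_ne_zero.2 hn
  rw [key n, mul_sub, ← mul_assoc, inv_mul_cancel₀ this, one_mul]

/-- If the averages of a sequence are at most `K ≥ 0`, then its sums with weights
`(i + 1)⁻²` are at most `2 K`. -/
theorem sum_div_sq_le {u : ℕ → ℝ} {K : ℝ} (hK : 0 ≤ K)
    (h : ∀ n : ℕ, ∑ i ∈ Finset.range n, u i ≤ K * n) (n : ℕ) :
    ∑ i ∈ Finset.range n, u i / (i + 1 : ℝ) ^ 2 ≤ 2 * K := by
  -- The partial sums of `K - u i` are nonnegative and the weights decrease, so replacing all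
  -- weights by the next smaller one only lowers the sum.
  have habel : ∀ n : ℕ, (K * n - ∑ i ∈ Finset.range n, u i) / (n + 1 : ℝ) ^ 2 ≤
      ∑ i ∈ Finset.range n, (K - u i) / (i + 1 : ℝ) ^ 2 := by
    intro n
    induction n with
    | zero => simp
    | succ n ih =>
      have hn := h (n + 1)
      have h1 : (K * (n + 1 : ℕ) - ∑ i ∈ Finset.range (n + 1), u i) / ((n + 1 : ℕ) + 1 : ℝ) ^ 2 ≤
          (K * (n + 1 : ℕ) - ∑ i ∈ Finset.range (n + 1), u i) / (n + 1 : ℝ) ^ 2 := by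
        apply div_le_div_of_nonneg_left (by linarith) (by positivity)
        push_cast
        gcongr
        linarith
      rw [Finset.sum_range_succ (fun i => (K - u i) / (i + 1 : ℝ) ^ 2)]
      refine h1.trans (le_trans (le_of_eq ?_) (add_le_add_left ih _))
      rw [Finset.sum_range_succ, ← add_div]
      push_cast
      ring
  have hnonneg : 0 ≤ ∑ i ∈ Finset.range n, (K - u i) / (i + 1 : ℝ) ^ 2 :=
    le_trans (div_nonneg (by linarith [h n]) (by positivity)) (habel n)
  -- Telescoping bound: `1 / (n + 1)² ≤ 2 / ((n + 1) (n + 2))`.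
  have hbound : ∀ n : ℕ, ∑ i ∈ Finset.range n, K / (i + 1 : ℝ) ^ 2 ≤ 2 * K - 2 * K / (n + 1) := by
    intro n
    induction n with
    | zero => simp
    | succ n ih =>
      have h1 : 2 * K / ((n : ℝ) + 1) - 2 * K / (n + 1 + 1) - K / (n + 1 : ℝ) ^ 2
          = K * n / ((n + 1) ^ 2 * (n + 1 + 1)) := by
        field_simp
        ring
      have h2 : 0 ≤ K * n / (((n : ℝ) + 1) ^ 2 * (n + 1 + 1)) := by positivity
      rw [Finset.sum_range_succ]
      push_cast
      linarith
  have h2 : 0 ≤ 2 * K / ((n : ℝ) + 1) := by positivity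
  have h3 := hbound n
  simp only [sub_div, Finset.sum_sub_distrib] at hnonneg
  linarith

/-- **Kolmogorov's strong law** for weighted sums of independent centered random variables with
equal variances, if the averages of the squared weights are bounded. -/
theorem ae_tendsto_average_of_iIndepFun {Ω : Type*} [MeasurableSpace Ω] {μ : Measure Ω}
    [IsProbabilityMeasure μ] {x : ℕ → Ω → ℝ} {s K : ℝ} (c : ℕ → ℝ)
    (hm : ∀ i, Measurable (x i)) (hind : iIndepFun x μ) (hL : ∀ i, MemLp (x i) 2 μ)
    (hmean : ∀ i, ∫ ω, x i ω ∂μ = 0) (hvar : ∀ i, variance (x i) μ = s)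
    (hc : ∀ n : ℕ, ∑ i ∈ Finset.range n, c i ^ 2 ≤ K * n) :
    ∀ᵐ ω ∂μ, Tendsto (fun n : ℕ => (n : ℝ)⁻¹ * ∑ i ∈ Finset.range n, c i * x i ω)
      atTop (𝓝 0) := by
  have hK : 0 ≤ K := by
    have := hc 1
    simp at this
    nlinarith [sq_nonneg (c 0)]
  have hs : 0 ≤ s := hvar 0 ▸ variance_nonneg _ _
  set y : ℕ → Ω → ℝ := fun i ω => c i / (i + 1) * x i ω with hy
  have hym : ∀ i, StronglyMeasurable (y i) := fun i => ((hm i).const_mul _).stronglyMeasurable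
  have hyind : iIndepFun y μ :=
    hind.comp (fun i t => c i / (i + 1) * t) fun i => measurable_const_mul _
  have hyL : ∀ i, MemLp (y i) 2 μ := fun i => (hL i).const_mul _
  have hymean : ∀ i, ∫ ω, y i ω ∂μ = 0 := fun i => by simp [hy, integral_const_mul, hmean]
  have hyvar : ∀ i, variance (y i) μ = c i ^ 2 / (i + 1 : ℝ) ^ 2 * s := fun i => by
    rw [hy, variance_const_mul, hvar, div_pow]
  -- The range is `n + 1` so that `S n` involves `y 0, …, y n` and is adapted to the natural
  -- filtration. This martingale is bounded in `L²`, hence in `L¹`, so it converges almost surely,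
  -- and Kronecker's lemma applies.
  set S : ℕ → Ω → ℝ := fun n ω => ∑ i ∈ Finset.range (n + 1), y i ω with hS
  have hSL : ∀ n, MemLp (S n) 2 μ := fun n => memLp_finsetSum _ fun i _ => hyL i
  have hmart : Martingale S (Filtration.natural y hym) μ := by
    refine martingale_nat ?_ (fun n => (hSL n).integrable one_le_two) fun n => ?_
    · intro n
      refine Finset.stronglyMeasurable_fun_sum _ fun i hi => ?_
      exact (Filtration.stronglyAdapted_natural hym i).mono
        ((Filtration.natural y hym).mono (Nat.lt_succ_iff.1 (Finset.mem_range.1 hi)))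
    · have hsplit : S (n + 1) = S n + y (n + 1) := by
        ext ω
        simp [hS, Finset.sum_range_succ]
      have h1 := condExp_add (μ := μ) ((hSL n).integrable one_le_two)
        ((hyL (n + 1)).integrable one_le_two) (Filtration.natural y hym n)
      have h2 : μ[S n | Filtration.natural y hym n] = S n := by
        refine condExp_of_stronglyMeasurable ((Filtration.natural y hym).le n) ?_
          ((hSL n).integrable one_le_two)
        refine Finset.stronglyMeasurable_fun_sum _ fun i hi => ?_
        exact (Filtration.stronglyAdapted_natural hym i).mono
          ((Filtration.natural y hym).mono (Nat.lt_succ_iff.1 (Finset.mem_range.1 hi)))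
      have h3 := hyind.condExp_natural_ae_eq_of_lt hym (Nat.lt_succ_self n)
      rw [hsplit]
      filter_upwards [h1, h3] with ω h1 h3
      rw [h1, Pi.add_apply, h2, h3, hymean, add_zero]
  have hvarS : ∀ n, variance (S n) μ ≤ 2 * K * s := by
    intro n
    have : S n = ∑ i ∈ Finset.range (n + 1), y i := by
      ext ω
      simp [hS]
    rw [this, IndepFun.variance_sum (fun i _ => hyL i) fun i _ j _ hij => hyind.indepFun hij]
    simp only [hyvar, ← Finset.sum_mul]
    exact mul_le_mul_of_nonneg_right (sum_div_sq_le hK hc _) hs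
  have hbdd : ∀ n, eLpNorm (S n) 1 μ ≤ (Real.sqrt (2 * K * s)).toNNReal := by
    intro n
    have hmeanS : ∫ ω, S n ω ∂μ = 0 := by
      rw [hS, integral_finsetSum _ fun i _ => (hyL i).integrable one_le_two]
      simp [hymean]
    have hv := variance_of_integral_eq_zero (hSL n).aestronglyMeasurable.aemeasurable hmeanS
    refine (eLpNorm_le_eLpNorm_of_exponent_le one_le_two (hSL n).1).trans ?_
    rw [(hSL n).eLpNorm_eq_integral_rpow_norm two_ne_zero ENNReal.ofNat_ne_top]
    apply ENNReal.ofReal_le_ofReal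
    rw [Real.sqrt_eq_rpow]
    have : ∫ ω, ‖S n ω‖ ^ (2 : ENNReal).toReal ∂μ = variance (S n) μ := by
      rw [hv]
      simp
    rw [this]
    norm_num
    exact Real.rpow_le_rpow (variance_nonneg _ _) (hvarS n) (by norm_num)
  filter_upwards [hmart.submartingale.exists_ae_tendsto_of_bdd hbdd] with ω ⟨a, ha⟩
  refine tendsto_average_of_tendsto_sum_div (s := a) ?_
  refine (tendsto_add_atTop_iff_nat 1).1 (ha.congr fun n => ?_)
  exact Finset.sum_congr rfl fun i _ => by simp only [hy]; ring

namespace CTLS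

theorem ErrorAssumption.ae_tendsto_average_mul {Ω ν : Type*} [MeasurableSpace Ω] [DecidableEq ν]
    {μ : Measure Ω} [IsProbabilityMeasure μ] {E : ℕ → Ω → ν → ℝ} {σ : ℝ}
    (hE : ErrorAssumption μ E σ) {c : ℕ → ℝ} {K : ℝ}
    (hc : ∀ n : ℕ, ∑ i ∈ Finset.range n, c i ^ 2 ≤ K * n) (a : ν) :
    ∀ᵐ ω ∂μ, Tendsto (fun n : ℕ => (n : ℝ)⁻¹ * ∑ i ∈ Finset.range n, c i * E i ω a)
      atTop (𝓝 0) := by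
  refine ae_tendsto_average_of_iIndepFun (s := σ ^ 2) (x := fun i ω => E i ω a) c
    (fun i => (measurable_pi_apply a).comp (hE.measurable i))
    (hE.indep.comp (fun _ v => v a) fun _ => measurable_pi_apply a)
    (fun i => hE.memLp i a) (fun i => hE.mean i a) (fun i => ?_) hc
  rw [← covariance_self (hE.memLp i a).aestronglyMeasurable.aemeasurable, hE.cov]
  simp

/-- The products are identically distributed, pairwise independent and integrable, so the usual
strong law applies; their mean is the covariance because the errors are centered. -/
theorem ErrorAssumption.ae_tendsto_average_mul_self {Ω ν : Type*} [MeasurableSpace Ω]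
    [DecidableEq ν] {μ : Measure Ω} [IsProbabilityMeasure μ] {E : ℕ → Ω → ν → ℝ} {σ : ℝ}
    (hE : ErrorAssumption μ E σ) (a b : ν) :
    ∀ᵐ ω ∂μ, Tendsto (fun n : ℕ => (n : ℝ)⁻¹ * ∑ i ∈ Finset.range n, E i ω a * E i ω b)
      atTop (𝓝 ((σ ^ 2 • (1 : Matrix ν ν ℝ)) a b)) := by
  have hmul : Measurable fun v : ν → ℝ => v a * v b :=
    (measurable_pi_apply a).mul (measurable_pi_apply b)
  have h := strong_law_ae_real (μ := μ) (fun i ω => E i ω a * E i ω b)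
    ((hE.memLp 0 a).integrable_mul (hE.memLp 0 b))
    (fun i j hij => (hE.indep.indepFun hij).comp hmul hmul)
    (fun i => (hE.identDistrib i).comp hmul)
  have hcov := hE.cov 0 a b
  rw [covariance_eq_sub (hE.memLp 0 a) (hE.memLp 0 b), hE.mean, zero_mul, sub_zero] at hcov
  filter_upwards [h] with ω hω
  rw [← hcov]
  exact hω.congr fun n => div_eq_inv_mul _ _

/-! ### Ordered eigendecompositions and Ky Fan's principle -/

/-- `W` is an orthogonal matrix whose columns are eigenvectors of `M`, for the eigenvalues `θ` in
increasing order. -/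
structure IsEigenDecomposition {N : ℕ} (M W : Matrix (Fin N) (Fin N) ℝ) (θ : Fin N → ℝ) :
    Prop where
  monotone : Monotone θ
  orthogonal : Wᵀ * W = 1
  eigen : M * W = W * diagonal θ

theorem IsEigenDecomposition.orthogonal' {N : ℕ} {M W : Matrix (Fin N) (Fin N) ℝ} {θ : Fin N → ℝ}
    (h : IsEigenDecomposition M W θ) : W * Wᵀ = 1 :=
  mul_eq_one_comm.1 h.orthogonal

theorem IsEigenDecomposition.eq {N : ℕ} {M W : Matrix (Fin N) (Fin N) ℝ} {θ : Fin N → ℝ}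
    (h : IsEigenDecomposition M W θ) : M = W * diagonal θ * Wᵀ := by
  rw [← h.eigen, Matrix.mul_assoc, h.orthogonal', Matrix.mul_one]

/-- The spectral theorem, with eigenvalues and eigenvectors permuted together into increasing order.
-/
theorem exists_isEigenDecomposition {N : ℕ} {M : Matrix (Fin N) (Fin N) ℝ} (hM : Mᵀ = M) :
    ∃ W θ, IsEigenDecomposition M W θ := by
  have hH : M.IsHermitian := by rwa [IsHermitian, conjTranspose_eq_transpose_of_trivial]
  set U : Matrix (Fin N) (Fin N) ℝ := (hH.eigenvectorUnitary : Matrix (Fin N) (Fin N) ℝ) with hU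
  have hUU : Uᵀ * U = 1 := by
    have := (mem_unitaryGroup_iff' (A := U)).1 hH.eigenvectorUnitary.2
    rwa [star_eq_conjTranspose, conjTranspose_eq_transpose_of_trivial] at this
  have hMU : M * U = U * diagonal hH.eigenvalues := by
    ext i j
    rw [mul_diagonal]
    have := congrFun (hH.mulVec_eigenvectorBasis j) i
    simp only [mulVec, dotProduct, Pi.smul_apply, smul_eq_mul] at this
    simp only [Matrix.mul_apply, hU, hH.eigenvectorUnitary_apply]
    rw [mul_comm]
    exact this
  set s := Tuple.sort hH.eigenvalues with hs
  refine ⟨U.submatrix id s, hH.eigenvalues ∘ s, Tuple.monotone_sort _, ?_, ?_⟩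
  · ext i j
    have := congrFun (congrFun hUU (s i)) (s j)
    simp only [Matrix.mul_apply, transpose_apply, submatrix_apply, id, one_apply,
      s.injective.eq_iff] at this ⊢
    exact this
  · ext i j
    have := congrFun (congrFun hMU i) (s j)
    rw [mul_diagonal] at this ⊢
    simpa [Matrix.mul_apply] using this

/-- The diagonal entries of an orthogonal projection lie in the unit interval. -/
theorem diag_nonneg_of_proj {ι : Type*} [Fintype ι] {Q : Matrix ι ι ℝ} (hQ : Qᵀ = Q)
    (hQQ : Q * Q = Q) (i : ι) : 0 ≤ Q i i ∧ Q i i ≤ 1 ∧ (Q i i = 0 → ∀ j, Q i j = 0) := by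
  -- The diagonal entry is the squared norm of its row; all three claims follow.
  have h : Q i i = ∑ j, Q i j ^ 2 := by
    conv_lhs => rw [← hQQ, Matrix.mul_apply]
    refine Finset.sum_congr rfl fun j _ => ?_
    rw [sq, show Q j i = Q i j from congrFun (congrFun hQ i) j]
  have h0 : Q i i ^ 2 ≤ Q i i := by
    conv_rhs => rw [h]
    exact Finset.single_le_sum (f := fun j => Q i j ^ 2) (fun j _ => sq_nonneg _)
      (Finset.mem_univ i)
  refine ⟨h ▸ Finset.sum_nonneg fun j _ => sq_nonneg _, by nlinarith, fun hi j => ?_⟩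
  rw [hi] at h
  have := (Finset.sum_eq_zero_iff_of_nonneg fun j _ => sq_nonneg (Q i j)).1 h.symm j
    (Finset.mem_univ j)
  simpa using this

/-- A quantitative form of **Ky Fan's minimum principle** for the `l` smallest eigenvalues. -/
theorem IsEigenDecomposition.ky_fan {l d : ℕ} {M W : Matrix (Fin (l + d)) (Fin (l + d)) ℝ}
    {θ : Fin (l + d) → ℝ} (h : IsEigenDecomposition M W θ) {a b : ℝ}
    (ha : ∀ i, θ (Fin.castAdd d i) ≤ a) (hb : ∀ i, b ≤ θ (Fin.natAdd l i))
    {Q : Matrix (Fin (l + d)) (Fin (l + d)) ℝ} (hQ : Qᵀ = Q) (hQQ : Q * Q = Q)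
    (htr : Q.trace = l) :
    ∑ i, θ (Fin.castAdd d i) + (b - a) * ∑ i, (Wᵀ * Q * W) (Fin.natAdd l i) (Fin.natAdd l i)
      ≤ (Q * M).trace := by
  -- In the eigenbasis the trace is `∑ θ i * R i i`, with weights in `[0, 1]` of total `l`. Each
  -- unit of weight moved from the low to the high indices costs at least `b - a`.
  set R := Wᵀ * Q * W with hR
  have hRt : Rᵀ = R := by
    simp only [hR, transpose_mul, transpose_transpose, hQ, Matrix.mul_assoc]
  have hRR : R * R = R := by
    calc R * R = Wᵀ * Q * (W * Wᵀ) * Q * W := by simp only [hR, Matrix.mul_assoc]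
      _ = R := by rw [h.orthogonal', Matrix.mul_one, Matrix.mul_assoc Wᵀ, hQQ]
  have hRtr : ∑ i, R (Fin.castAdd d i) (Fin.castAdd d i)
      + ∑ i, R (Fin.natAdd l i) (Fin.natAdd l i) = l := by
    rw [← htr, ← Fin.sum_univ_add (f := fun i => R i i)]
    change R.trace = Q.trace
    rw [hR, Matrix.mul_assoc, trace_mul_comm, Matrix.mul_assoc, h.orthogonal', Matrix.mul_one]
  have hQM : (Q * M).trace = ∑ i, R (Fin.castAdd d i) (Fin.castAdd d i) * θ (Fin.castAdd d i)
      + ∑ i, R (Fin.natAdd l i) (Fin.natAdd l i) * θ (Fin.natAdd l i) := by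
    have : (Q * M).trace = (R * diagonal θ).trace := by
      conv_lhs => rw [h.eq]
      rw [hR, ← Matrix.mul_assoc, trace_mul_comm, ← Matrix.mul_assoc, ← Matrix.mul_assoc]
    rw [this, ← Fin.sum_univ_add (f := fun i => R i i * θ i)]
    simp [trace, mul_diagonal]
  have h1 : ∑ i, (θ (Fin.castAdd d i) - a * (1 - R (Fin.castAdd d i) (Fin.castAdd d i))) ≤
      ∑ i, R (Fin.castAdd d i) (Fin.castAdd d i) * θ (Fin.castAdd d i) := by
    refine Finset.sum_le_sum fun i _ => ?_
    nlinarith [ha i, (diag_nonneg_of_proj hRt hRR (Fin.castAdd d i)).2.1]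
  have h2 : ∑ i, b * R (Fin.natAdd l i) (Fin.natAdd l i) ≤
      ∑ i, R (Fin.natAdd l i) (Fin.natAdd l i) * θ (Fin.natAdd l i) := by
    refine Finset.sum_le_sum fun i _ => ?_
    nlinarith [hb i, (diag_nonneg_of_proj hRt hRR (Fin.natAdd l i)).1]
  rw [hQM]
  rw [Finset.sum_sub_distrib, ← Finset.mul_sum, Finset.sum_sub_distrib] at h1
  rw [← Finset.mul_sum] at h2
  simp only [Finset.sum_const, Finset.card_univ, Fintype.card_fin, nsmul_eq_mul, mul_one] at h1
  have h3 : (l : ℝ) - ∑ i, R (Fin.castAdd d i) (Fin.castAdd d i)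
      = ∑ i, R (Fin.natAdd l i) (Fin.natAdd l i) := by linarith
  rw [h3] at h1
  linarith

section Low

variable {l d : ℕ} {ν : Type*}

/-- The first `l` columns. -/
def lowCols (d : ℕ) (A : Matrix ν (Fin (l + d)) ℝ) : Matrix ν (Fin l) ℝ :=
  A.submatrix id (Fin.castAdd d)

/-- The last `d` columns. -/
def highCols (l : ℕ) (A : Matrix ν (Fin (l + d)) ℝ) : Matrix ν (Fin d) ℝ :=
  A.submatrix id (Fin.natAdd l)

variable {M W : Matrix (Fin (l + d)) (Fin (l + d)) ℝ} {θ : Fin (l + d) → ℝ}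

theorem lowCols_mul (P : Matrix ν (Fin (l + d)) ℝ) :
    lowCols d (P * W) = P * lowCols d W := by
  ext i j
  simp [lowCols, Matrix.mul_apply]

theorem IsEigenDecomposition.low_orthonormal (h : IsEigenDecomposition M W θ) :
    (lowCols d W)ᵀ * lowCols d W = 1 := by
  ext i j
  have := congrFun (congrFun h.orthogonal (Fin.castAdd d i)) (Fin.castAdd d j)
  simp only [Matrix.mul_apply, transpose_apply, one_apply, Fin.castAdd_inj] at this
  simpa [lowCols, Matrix.mul_apply, one_apply] using this

theorem IsEigenDecomposition.high_mul_low (h : IsEigenDecomposition M W θ) :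
    (highCols l W)ᵀ * lowCols d W = 0 := by
  ext i j
  have := congrFun (congrFun h.orthogonal (Fin.natAdd l i)) (Fin.castAdd d j)
  rw [one_apply_ne (by rw [Ne, Fin.ext_iff, Fin.val_natAdd, Fin.val_castAdd]; omega)] at this
  simpa [lowCols, highCols, Matrix.mul_apply] using this

theorem IsEigenDecomposition.low_add_high (h : IsEigenDecomposition M W θ) :
    lowCols d W * (lowCols d W)ᵀ + highCols l W * (highCols l W)ᵀ = 1 := by
  rw [← h.orthogonal']
  ext i j
  simp [lowCols, highCols, Matrix.mul_apply, Fin.sum_univ_add]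

theorem IsEigenDecomposition.mul_low (h : IsEigenDecomposition M W θ) :
    M * lowCols d W = lowCols d W * diagonal fun i => θ (Fin.castAdd d i) := by
  rw [← lowCols_mul, h.eigen]
  ext i j
  simp [lowCols, mul_diagonal]

theorem IsEigenDecomposition.mul_high (h : IsEigenDecomposition M W θ) :
    M * highCols l W = highCols l W * diagonal fun i => θ (Fin.natAdd l i) := by
  ext i j
  have := congrFun (congrFun h.eigen i) (Fin.natAdd l j)
  rw [mul_diagonal] at this ⊢
  simpa [highCols, Matrix.mul_apply] using this

/-- The orthogonal projection onto the span of the first `l` columns. -/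
def lowProj (d : ℕ) (W : Matrix ν (Fin (l + d)) ℝ) : Matrix ν ν ℝ :=
  lowCols d W * (lowCols d W)ᵀ

theorem lowProj_transpose (W : Matrix ν (Fin (l + d)) ℝ) : (lowProj d W)ᵀ = lowProj d W := by
  simp [lowProj]

theorem IsEigenDecomposition.lowProj_mul_self (h : IsEigenDecomposition M W θ) :
    lowProj d W * lowProj d W = lowProj d W := by
  rw [lowProj, Matrix.mul_assoc, ← Matrix.mul_assoc _ (lowCols d W), h.low_orthonormal,
    Matrix.one_mul]

theorem IsEigenDecomposition.trace_lowProj (h : IsEigenDecomposition M W θ) :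
    (lowProj d W).trace = l := by
  rw [lowProj, trace_mul_comm, h.low_orthonormal]
  simp

theorem IsEigenDecomposition.trace_lowProj_mul (h : IsEigenDecomposition M W θ) :
    (lowProj d W * M).trace = ∑ i, θ (Fin.castAdd d i) := by
  rw [trace_mul_comm, lowProj, ← Matrix.mul_assoc, h.mul_low, trace_mul_comm, ← Matrix.mul_assoc,
    h.low_orthonormal, Matrix.one_mul, trace_diagonal]

/-- A common threshold `a = b = c` makes the gap term in `ky_fan` vanish, so the plain inequality
needs no gap. The largest low value serves, or the smallest high one if `l = 0`. -/
theorem exists_separating {θ : Fin (l + d) → ℝ} (hθ : Monotone θ) :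
    ∃ c, (∀ i, θ (Fin.castAdd d i) ≤ c) ∧ ∀ i, c ≤ θ (Fin.natAdd l i) := by
  rcases Nat.eq_zero_or_pos l with rfl | hl
  · rcases Nat.eq_zero_or_pos d with rfl | hd
    · exact ⟨0, fun i => i.elim0, fun i => i.elim0⟩
    · exact ⟨θ (Fin.natAdd 0 ⟨0, hd⟩), fun i => i.elim0, fun i => hθ (by
        simp [Fin.le_def])⟩
  · refine ⟨θ (Fin.castAdd d ⟨l - 1, by omega⟩), fun i => hθ ?_, fun i => hθ ?_⟩
    · simp only [Fin.le_def, Fin.val_castAdd]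
      omega
    · simp only [Fin.le_def, Fin.val_castAdd, Fin.val_natAdd]
      omega

theorem IsEigenDecomposition.sum_low_le (h : IsEigenDecomposition M W θ)
    {Q : Matrix (Fin (l + d)) (Fin (l + d)) ℝ} (hQ : Qᵀ = Q) (hQQ : Q * Q = Q)
    (htr : Q.trace = l) : ∑ i, θ (Fin.castAdd d i) ≤ (Q * M).trace := by
  obtain ⟨c, hc1, hc2⟩ := exists_separating h.monotone
  simpa using h.ky_fan hc1 hc2 hQ hQQ htr

/-- In Ky Fan's minimum principle, a minimizer is unique if there is a gap. -/
theorem IsEigenDecomposition.eq_of_trace_le (h : IsEigenDecomposition M W θ) {a b : ℝ}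
    (hab : a < b) (ha : ∀ i, θ (Fin.castAdd d i) ≤ a) (hb : ∀ i, b ≤ θ (Fin.natAdd l i))
    {Q : Matrix (Fin (l + d)) (Fin (l + d)) ℝ} (hQ : Qᵀ = Q) (hQQ : Q * Q = Q)
    (htr : Q.trace = l) (hle : (Q * M).trace ≤ ∑ i, θ (Fin.castAdd d i)) :
    lowProj d W * Q = Q := by
  have hk := h.ky_fan ha hb hQ hQQ htr
  set R := Wᵀ * Q * W with hR
  have hRt : Rᵀ = R := by
    simp only [hR, transpose_mul, transpose_transpose, hQ, Matrix.mul_assoc]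
  have hRR : R * R = R := by
    calc R * R = Wᵀ * Q * (W * Wᵀ) * Q * W := by simp only [hR, Matrix.mul_assoc]
      _ = R := by rw [h.orthogonal', Matrix.mul_one, Matrix.mul_assoc Wᵀ, hQQ]
  have hpos : ∀ i ∈ Finset.univ, 0 ≤ R (Fin.natAdd l i) (Fin.natAdd l i) := fun i _ =>
    (diag_nonneg_of_proj hRt hRR _).1
  -- Since `a < b`, equality leaves no weight on the high indices, and a projection with a zero
  -- diagonal entry has a zero row there.
  have hsum : ∑ i, R (Fin.natAdd l i) (Fin.natAdd l i) = 0 := by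
    have := Finset.sum_nonneg hpos
    nlinarith
  have hzero : ∀ i j, R (Fin.natAdd l i) j = 0 := fun i =>
    (diag_nonneg_of_proj hRt hRR _).2.2
      ((Finset.sum_eq_zero_iff_of_nonneg hpos).1 hsum i (Finset.mem_univ i))
  have hWQ : (highCols l W)ᵀ * Q = 0 := by
    have h1 : (highCols l W)ᵀ * Q = ((highCols l W)ᵀ * Q * W) * Wᵀ := by
      rw [Matrix.mul_assoc _ W, h.orthogonal', Matrix.mul_one]
    have h2 : (highCols l W)ᵀ * Q * W = 0 := by
      ext i j
      exact hzero i j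
    rw [h1, h2, Matrix.zero_mul]
  calc lowProj d W * Q
      = (lowCols d W * (lowCols d W)ᵀ + highCols l W * (highCols l W)ᵀ) * Q := by
        rw [Matrix.add_mul, Matrix.mul_assoc (highCols l W), hWQ, Matrix.mul_zero, add_zero,
          lowProj]
    _ = Q := by rw [h.low_add_high, Matrix.one_mul]

end Low

/-! ### Column projections and the Frobenius norm -/

section Projection

variable {ι κ : Type*} [Fintype ι] [Fintype κ] [DecidableEq κ]

/-- The orthogonal projection onto the column space of `V`, if `V` has full column rank. -/
noncomputable def colProj (V : Matrix ι κ ℝ) : Matrix ι ι ℝ := V * (Vᵀ * V)⁻¹ * Vᵀ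

theorem colProj_transpose (V : Matrix ι κ ℝ) : (colProj V)ᵀ = colProj V := by
  simp [colProj, transpose_nonsing_inv, Matrix.mul_assoc]

theorem colProj_mul (V : Matrix ι κ ℝ) (hV : IsUnit (Vᵀ * V)) : colProj V * V = V := by
  rw [colProj, Matrix.mul_assoc, Matrix.mul_assoc,
    nonsing_inv_mul _ ((isUnit_iff_isUnit_det _).1 hV), Matrix.mul_one]

theorem colProj_mul_self (V : Matrix ι κ ℝ) (hV : IsUnit (Vᵀ * V)) :
    colProj V * colProj V = colProj V := by
  conv_lhs => rhs; rw [colProj, Matrix.mul_assoc]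
  rw [← Matrix.mul_assoc, colProj_mul V hV, ← Matrix.mul_assoc, colProj]

theorem trace_colProj (V : Matrix ι κ ℝ) (hV : IsUnit (Vᵀ * V)) :
    (colProj V).trace = Fintype.card κ := by
  rw [colProj, Matrix.mul_assoc, trace_mul_comm, Matrix.mul_assoc,
    nonsing_inv_mul _ ((isUnit_iff_isUnit_det _).1 hV), trace_one]

end Projection

section Frobenius

variable {ι κ lam : Type*} [Fintype ι] [Fintype κ] [Fintype lam]

theorem frobSq_eq_trace (M : Matrix ι κ ℝ) : frobSq M = (Mᵀ * M).trace := by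
  simp only [frobSq, trace, diag_apply, Matrix.mul_apply, transpose_apply, ← sq]
  exact Finset.sum_comm

theorem frobSq_transpose (M : Matrix ι κ ℝ) : frobSq Mᵀ = frobSq M := Finset.sum_comm

theorem frobSq_neg (M : Matrix ι κ ℝ) : frobSq (-M) = frobSq M := by simp [frobSq]

theorem frobSq_nonneg (M : Matrix ι κ ℝ) : 0 ≤ frobSq M :=
  Finset.sum_nonneg fun _ _ => Finset.sum_nonneg fun _ _ => sq_nonneg _

theorem frobSq_eq_zero {M : Matrix ι κ ℝ} (h : frobSq M = 0) : M = 0 := by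
  ext i j
  have h1 := (Finset.sum_eq_zero_iff_of_nonneg fun i _ =>
    Finset.sum_nonneg fun c _ => sq_nonneg (M i c)).1 h i (Finset.mem_univ i)
  have h2 := (Finset.sum_eq_zero_iff_of_nonneg fun c _ => sq_nonneg (M i c)).1 h1 j
    (Finset.mem_univ j)
  simpa using h2

theorem frobSq_zero : frobSq (0 : Matrix ι κ ℝ) = 0 := by simp [frobSq]

theorem frobSq_fromCols (A : Matrix ι κ ℝ) (B : Matrix ι lam ℝ) :
    frobSq (fromCols A B) = frobSq A + frobSq B := by
  simp [frobSq, Finset.sum_add_distrib]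

theorem frobSq_add_of_transpose_mul {A B : Matrix ι κ ℝ} (h : Aᵀ * B = 0) :
    frobSq (A + B) = frobSq A + frobSq B := by
  have h' : Bᵀ * A = 0 := by
    rw [← transpose_transpose A, ← transpose_mul, h, transpose_zero]
  simp only [frobSq_eq_trace, transpose_add, Matrix.add_mul, Matrix.mul_add, h, h', add_zero,
    zero_add, trace_add]

theorem frobSq_add_of_mul_transpose {A B : Matrix ι κ ℝ} (h : A * Bᵀ = 0) :
    frobSq (A + B) = frobSq A + frobSq B := by
  rw [← frobSq_transpose, transpose_add, frobSq_add_of_transpose_mul, frobSq_transpose,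
    frobSq_transpose]
  rwa [transpose_transpose]

end Frobenius

/-! ### Eliminating the correction and the upper part -/

section Reduction

variable {ι κ ν : Type*} [Fintype ι] [Fintype κ] [DecidableEq κ]

/-- The coefficients of the least squares regression of the columns of `C` on those of `A`. -/
noncomputable def regr (A : Matrix ι κ ℝ) (C : Matrix ι ν ℝ) : Matrix κ ν ℝ :=
  (Aᵀ * A)⁻¹ * (Aᵀ * C)

theorem transpose_mul_regr {A : Matrix ι κ ℝ} (hA : IsUnit (Aᵀ * A)) (C : Matrix ι ν ℝ) :
    Aᵀ * A * regr A C = Aᵀ * C := by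
  rw [regr, ← Matrix.mul_assoc, mul_nonsing_inv _ ((isUnit_iff_isUnit_det _).1 hA),
    Matrix.one_mul]

theorem transpose_mul_sub_regr {A : Matrix ι κ ℝ} (hA : IsUnit (Aᵀ * A)) (C : Matrix ι ν ℝ) :
    Aᵀ * (C - A * regr A C) = 0 := by
  rw [Matrix.mul_sub, ← Matrix.mul_assoc, transpose_mul_regr hA, sub_self]

/-- The residuals `C - A * regr A C` are orthogonal to the columns of `A`, so `gram` is their Gram
matrix; this gives its positivity and its role in the objective. -/
theorem gram_eq {A : Matrix ι κ ℝ} (hA : IsUnit (Aᵀ * A)) (C : Matrix ι ν ℝ) :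
    gram A C = (C - A * regr A C)ᵀ * (C - A * regr A C) := by
  rw [transpose_sub, Matrix.sub_mul, transpose_mul, Matrix.mul_assoc,
    transpose_mul_sub_regr hA, Matrix.mul_zero, sub_zero, Matrix.mul_sub, gram, regr]
  simp only [Matrix.mul_assoc]

theorem gram_transpose (A : Matrix ι κ ℝ) (C : Matrix ι ν ℝ) : (gram A C)ᵀ = gram A C := by
  simp [gram, transpose_nonsing_inv, Matrix.mul_assoc]

variable {lam : Type*} [Fintype ν] [Fintype lam] [DecidableEq lam]

/-- Decomposition of the squared norm of a correction `Δ` with `A X₁ + (C + Δ) V = 0`. -/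
theorem frobSq_correction {A : Matrix ι κ ℝ} (hA : IsUnit (Aᵀ * A)) {C Δ : Matrix ι ν ℝ}
    {V : Matrix ν lam ℝ} (hV : IsUnit (Vᵀ * V)) {X₁ : Matrix κ lam ℝ}
    (h : A * X₁ + (C + Δ) * V = 0) :
    frobSq Δ = frobSq (Δ - Δ * colProj V)
      + frobSq (A * ((X₁ + regr A C * V) * ((Vᵀ * V)⁻¹ * Vᵀ)))
      + (colProj V * gram A C).trace := by
  have hQ := colProj_transpose V
  have hQQ := colProj_mul_self V hV
  have h1 : frobSq Δ = frobSq (Δ - Δ * colProj V) + frobSq (Δ * colProj V) := by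
    conv_lhs => rw [← sub_add_cancel Δ (Δ * colProj V)]
    refine frobSq_add_of_mul_transpose ?_
    rw [transpose_mul, hQ, Matrix.sub_mul, Matrix.mul_assoc Δ (colProj V),
      ← Matrix.mul_assoc (colProj V) (colProj V), hQQ, sub_self]
  have h2 : Δ * V = -(A * (X₁ + regr A C * V) + (C - A * regr A C) * V) := by
    rw [Matrix.add_mul] at h
    rw [Matrix.mul_add, Matrix.sub_mul, Matrix.mul_assoc A (regr A C), add_add_sub_cancel,
      eq_neg_iff_add_eq_zero, ← h]
    abel
  -- The constraint fixes `Δ * V`, hence `Δ * colProj V`; its parts along the columns of `A` and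
  -- orthogonal to them give the last two terms.
  have h3 : Δ * colProj V = -(A * ((X₁ + regr A C * V) * ((Vᵀ * V)⁻¹ * Vᵀ))
      + (C - A * regr A C) * colProj V) := by
    rw [colProj, Matrix.mul_assoc V, ← Matrix.mul_assoc Δ, h2, Matrix.neg_mul, Matrix.add_mul]
    simp only [Matrix.mul_assoc]
  have h4 : frobSq ((C - A * regr A C) * colProj V) = (colProj V * gram A C).trace := by
    rw [frobSq_eq_trace, transpose_mul, hQ, Matrix.mul_assoc, ← Matrix.mul_assoc _ _ (colProj V),
      ← gram_eq hA, trace_mul_comm, Matrix.mul_assoc, hQQ, trace_mul_comm]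
  rw [h1, h3, frobSq_neg, frobSq_add_of_transpose_mul, h4, add_assoc]
  rw [transpose_mul, Matrix.mul_assoc, ← Matrix.mul_assoc Aᵀ, transpose_mul_sub_regr hA,
    Matrix.zero_mul, Matrix.mul_zero]

/-- The minimal correction for given `V`. -/
noncomputable def optCorrection (A : Matrix ι κ ℝ) (C : Matrix ι ν ℝ) (V : Matrix ν lam ℝ) :
    Matrix ι ν ℝ :=
  -((C - A * regr A C) * colProj V)

theorem optCorrection_feasible (A : Matrix ι κ ℝ) (C : Matrix ι ν ℝ) {V : Matrix ν lam ℝ}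
    (hV : IsUnit (Vᵀ * V)) : A * -(regr A C * V) + (C + optCorrection A C V) * V = 0 := by
  rw [optCorrection, Matrix.add_mul, Matrix.neg_mul, Matrix.mul_assoc, colProj_mul V hV,
    Matrix.sub_mul, Matrix.mul_neg, Matrix.mul_assoc]
  abel

theorem frobSq_optCorrection {A : Matrix ι κ ℝ} (hA : IsUnit (Aᵀ * A)) (C : Matrix ι ν ℝ)
    {V : Matrix ν lam ℝ} (hV : IsUnit (Vᵀ * V)) :
    frobSq (optCorrection A C V) = (colProj V * gram A C).trace := by
  rw [frobSq_correction hA hV (optCorrection_feasible A C hV)]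
  have h1 : optCorrection A C V - optCorrection A C V * colProj V = 0 := by
    rw [optCorrection, Matrix.neg_mul, Matrix.mul_assoc, colProj_mul_self V hV, sub_self]
  rw [h1, neg_add_cancel, Matrix.zero_mul, Matrix.mul_zero, frobSq_zero, add_zero,
    zero_add]

end Reduction

/-- The matrix `[X; -I]`. -/
def negAug {τ lam : Type*} [DecidableEq lam] (X : Matrix τ lam ℝ) : Matrix (τ ⊕ lam) lam ℝ :=
  fromRows X (-1 : Matrix lam lam ℝ)

theorem mul_negAug {ι τ lam : Type*} [Fintype τ] [Fintype lam] [DecidableEq lam]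
    (A : Matrix ι τ ℝ) (B : Matrix ι lam ℝ) (X : Matrix τ lam ℝ) :
    fromCols A B * negAug X = A * X - B := by
  rw [negAug, fromCols_mul_fromRows, Matrix.mul_neg, Matrix.mul_one, sub_eq_add_neg]

/-- The block `-I` gives full column rank whatever `X` is: `XᵀX + I` is positive definite. -/
theorem isUnit_negAug {τ lam : Type*} [Fintype τ] [Fintype lam]
    [DecidableEq lam] (X : Matrix τ lam ℝ) : IsUnit ((negAug X)ᵀ * negAug X) := by
  have h : (negAug X)ᵀ * negAug X = Xᵀ * X + 1 := by
    rw [negAug, transpose_fromRows, fromCols_mul_fromRows, transpose_neg, transpose_one,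
      Matrix.neg_mul, Matrix.mul_neg, neg_neg, Matrix.one_mul]
  rw [h]
  have h1 : (Xᵀ * X).PosSemidef := by
    have := posSemidef_conjTranspose_mul_self X
    rwa [conjTranspose_eq_transpose_of_trivial] at this
  exact (PosDef.posSemidef_add h1 PosDef.one).isUnit

section Feasible

variable {ρ ι κ τ lam : Type*} [Fintype κ] [Fintype τ] [Fintype lam] [DecidableEq lam]

theorem feasible_zero_iff {A₁₂ : Matrix ρ τ ℝ} {A₂₁ : Matrix ι κ ℝ} {A₂₂ : Matrix ι τ ℝ}
    {B₁ : Matrix ρ lam ℝ} {B₂ : Matrix ι lam ℝ} {X : Matrix (κ ⊕ τ) lam ℝ} {ΔA : Matrix ι τ ℝ}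
    {ΔB : Matrix ι lam ℝ} :
    Feasible 0 A₁₂ A₂₁ A₂₂ B₁ B₂ X ΔA ΔB ↔ A₁₂ * X.toRows₂ = B₁ ∧
      A₂₁ * X.toRows₁ + (fromCols A₂₂ B₂ + fromCols ΔA ΔB) * negAug X.toRows₂ = 0 := by
  have h : (fromCols A₂₂ B₂ + fromCols ΔA ΔB) * negAug X.toRows₂
      = (A₂₂ + ΔA) * X.toRows₂ - (B₂ + ΔB) := by
    rw [Matrix.add_mul, mul_negAug, mul_negAug, Matrix.add_mul]
    abel
  rw [Feasible, h, ← add_sub_assoc, sub_eq_zero]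
  conv_lhs => rw [← fromRows_toRows X]
  rw [fromBlocks_mul_fromRows, Matrix.zero_mul, zero_add, fromRows_ext_iff]

end Feasible

/-! ### The solution formula under a spectral gap -/

section Solution

variable {ρ ι κ : Type*} [Fintype ι] [Fintype κ] [DecidableEq κ] {q l d : ℕ}

/-- If there is a gap between the `l` smallest and the other eigenvalues of `Pᵀ G P`, and the
corresponding eigenvectors have a nonsingular lower block, then the solution of the constrained
total least squares problem is unique and explicit. -/
theorem isSolution_iff {A₁₂ : Matrix ρ (Fin q) ℝ} {B₁ : Matrix ρ (Fin l) ℝ} {A₂₁ : Matrix ι κ ℝ}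
    {A₂₂ : Matrix ι (Fin q) ℝ} {B₂ : Matrix ι (Fin l) ℝ}
    {P : Matrix (Fin q ⊕ Fin l) (Fin (l + d)) ℝ} (hP : Pᵀ * P = 1)
    (hCP : fromCols A₁₂ B₁ * P = 0)
    (hnull : ∀ Y : Matrix (Fin q) (Fin l) ℝ, A₁₂ * Y = B₁ → P * (Pᵀ * negAug Y) = negAug Y)
    (hA : IsUnit (A₂₁ᵀ * A₂₁)) {W : Matrix (Fin (l + d)) (Fin (l + d)) ℝ} {θ : Fin (l + d) → ℝ}
    (hW : IsEigenDecomposition (Pᵀ * gram A₂₁ (fromCols A₂₂ B₂) * P) W θ) {a b : ℝ}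
    (hab : a < b) (ha : ∀ i, θ (Fin.castAdd d i) ≤ a) (hb : ∀ i, b ≤ θ (Fin.natAdd l i))
    (hZ : IsUnit (P * lowCols d W).toRows₂) (X' : Matrix (κ ⊕ Fin q) (Fin l) ℝ) :
    IsSolution 0 A₁₂ A₂₁ A₂₂ B₁ B₂ X' ↔
      X'.toRows₂ = -((P * lowCols d W).toRows₁ * (P * lowCols d W).toRows₂⁻¹) ∧
      X'.toRows₁ = -(regr A₂₁ (fromCols A₂₂ B₂) * negAug X'.toRows₂) := by
  set C := fromCols A₂₂ B₂ with hC
  set G := gram A₂₁ C with hG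
  set Z := P * lowCols d W with hZdef
  set S := ∑ i, θ (Fin.castAdd d i) with hS
  have hZ' : IsUnit Z.toRows₂.det := (isUnit_iff_isUnit_det _).1 hZ
  set Y₀ := -(Z.toRows₁ * Z.toRows₂⁻¹) with hY₀
  -- `negAug Y₀` has the column space of `Z`, rescaled so that the lower block is `-I`.
  have hZY : negAug Y₀ = -(Z * Z.toRows₂⁻¹) := by
    rw [negAug, ← fromRows_toRows Z, fromRows_mul, fromRows_neg, toRows₂_fromRows,
      mul_nonsing_inv _ hZ', hY₀]
  have hY₀B : A₁₂ * Y₀ = B₁ := by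
    rw [← sub_eq_zero, ← mul_negAug, hZY, hZdef, Matrix.mul_assoc P, Matrix.mul_neg,
      ← Matrix.mul_assoc, hCP, Matrix.zero_mul, neg_zero]
  -- the reduced objective is a trace over an `l`-dimensional subspace
  have hproj : ∀ Y : Matrix (Fin q) (Fin l) ℝ, A₁₂ * Y = B₁ →
      ∃ Q : Matrix (Fin (l + d)) (Fin (l + d)) ℝ, Qᵀ = Q ∧ Q * Q = Q ∧ Q.trace = l ∧
        Q * (Pᵀ * negAug Y) = Pᵀ * negAug Y ∧
        (colProj (negAug Y) * G).trace = (Q * (Pᵀ * G * P)).trace := by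
    intro Y hY
    have h1 := hnull Y hY
    have hU : (Pᵀ * negAug Y)ᵀ * (Pᵀ * negAug Y) = (negAug Y)ᵀ * negAug Y := by
      conv_rhs => rw [← h1]
      rw [transpose_mul P, Matrix.mul_assoc, ← Matrix.mul_assoc Pᵀ, hP, Matrix.one_mul]
    have hunit : IsUnit ((Pᵀ * negAug Y)ᵀ * (Pᵀ * negAug Y)) := hU ▸ isUnit_negAug Y
    refine ⟨colProj (Pᵀ * negAug Y), colProj_transpose _, colProj_mul_self _ hunit, ?_,
      colProj_mul _ hunit, ?_⟩
    · rw [trace_colProj _ hunit, Fintype.card_fin]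
    · have h2 : colProj (negAug Y) = P * colProj (Pᵀ * negAug Y) * Pᵀ := by
        have h3 : (Pᵀ * negAug Y)ᵀ * Pᵀ = (negAug Y)ᵀ := by rw [← transpose_mul, h1]
        rw [colProj, colProj, hU, Matrix.mul_assoc P, Matrix.mul_assoc _ _ Pᵀ, h3,
          Matrix.mul_assoc (Pᵀ * negAug Y), ← Matrix.mul_assoc P, h1, ← Matrix.mul_assoc]
      rw [h2, Matrix.mul_assoc, Matrix.mul_assoc, trace_mul_comm]
      simp only [Matrix.mul_assoc]
  have hlow : ∀ Y : Matrix (Fin q) (Fin l) ℝ, A₁₂ * Y = B₁ →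
      S ≤ (colProj (negAug Y) * G).trace := by
    intro Y hY
    obtain ⟨Q, hQ, hQQ, htr, -, h⟩ := hproj Y hY
    exact h ▸ hW.sum_low_le hQ hQQ htr
  have heq : ∀ Y : Matrix (Fin q) (Fin l) ℝ, A₁₂ * Y = B₁ →
      (colProj (negAug Y) * G).trace ≤ S → Y = Y₀ := by
    intro Y hY hle
    obtain ⟨Q, hQ, hQQ, htr, hQY, h⟩ := hproj Y hY
    -- Equality in Ky Fan puts the columns of `negAug Y` into the span of `Z`; comparing lower
    -- blocks then fixes the coefficients `K`.
    have h1 := hW.eq_of_trace_le hab ha hb hQ hQQ htr (h ▸ hle)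
    have h2 : Pᵀ * negAug Y = lowCols d W * ((lowCols d W)ᵀ * (Pᵀ * negAug Y)) := by
      rw [← Matrix.mul_assoc, ← lowProj]
      conv_lhs => rw [← hQY, ← h1, Matrix.mul_assoc, hQY]
    have h3 : negAug Y = Z * ((lowCols d W)ᵀ * (Pᵀ * negAug Y)) := by
      conv_lhs => rw [← hnull Y hY, h2, ← Matrix.mul_assoc, ← hZdef]
    set K := (lowCols d W)ᵀ * (Pᵀ * negAug Y) with hK
    rw [negAug, ← fromRows_toRows Z, fromRows_mul, fromRows_ext_iff] at h3
    have h4 : K = -Z.toRows₂⁻¹ := by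
      rw [← Matrix.one_mul K, ← nonsing_inv_mul _ hZ', Matrix.mul_assoc, ← h3.2, Matrix.mul_neg,
        Matrix.mul_one]
    rw [h3.1, h4, Matrix.mul_neg]
  have hS₀ : (colProj (negAug Y₀) * G).trace = S := by
    have h1 : colProj (negAug Y₀) = Z * Zᵀ := by
      have hZZ : Zᵀ * Z = 1 := by
        rw [hZdef, transpose_mul, Matrix.mul_assoc, ← Matrix.mul_assoc Pᵀ, hP, Matrix.one_mul,
          hW.low_orthonormal]
      have h2 : ((negAug Y₀)ᵀ * negAug Y₀) = Z.toRows₂⁻¹ᵀ * Z.toRows₂⁻¹ := by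
        rw [hZY, transpose_neg, Matrix.neg_mul, Matrix.mul_neg, neg_neg, transpose_mul,
          Matrix.mul_assoc, ← Matrix.mul_assoc Zᵀ, hZZ, Matrix.one_mul]
      rw [colProj, h2, hZY, Matrix.mul_inv_rev, nonsing_inv_nonsing_inv _ hZ', transpose_neg,
        Matrix.mul_neg, Matrix.neg_mul, Matrix.neg_mul, neg_neg, transpose_mul,
        ← transpose_nonsing_inv, nonsing_inv_nonsing_inv _ hZ', Matrix.mul_assoc Z,
        ← Matrix.mul_assoc Z.toRows₂⁻¹, nonsing_inv_mul _ hZ', Matrix.one_mul, Matrix.mul_assoc,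
        ← Matrix.mul_assoc Z.toRows₂ᵀ, ← transpose_mul, nonsing_inv_mul _ hZ', transpose_one,
        Matrix.one_mul]
    rw [h1, hZdef, transpose_mul, Matrix.mul_assoc, Matrix.mul_assoc, trace_mul_comm, hS,
      ← hW.trace_lowProj_mul, lowProj]
    simp only [Matrix.mul_assoc]
  -- candidates for the minimum
  have hcand : ∀ Y : Matrix (Fin q) (Fin l) ℝ, A₁₂ * Y = B₁ →
      Feasible 0 A₁₂ A₂₁ A₂₂ B₁ B₂ (fromRows (-(regr A₂₁ C * negAug Y)) Y)
        (optCorrection A₂₁ C (negAug Y)).toCols₁ (optCorrection A₂₁ C (negAug Y)).toCols₂ := by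
    intro Y hY
    rw [feasible_zero_iff, toRows₁_fromRows, toRows₂_fromRows, fromCols_toCols]
    exact ⟨hY, optCorrection_feasible A₂₁ C (isUnit_negAug Y)⟩
  have hval : ∀ Y : Matrix (Fin q) (Fin l) ℝ,
      frobSq (optCorrection A₂₁ C (negAug Y)).toCols₁
        + frobSq (optCorrection A₂₁ C (negAug Y)).toCols₂ = (colProj (negAug Y) * G).trace := by
    intro Y
    rw [← frobSq_fromCols, fromCols_toCols, frobSq_optCorrection hA C (isUnit_negAug Y)]
  constructor
  · rintro ⟨ΔA, ΔB, hf, hmin⟩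
    obtain ⟨hf1, hf2⟩ := feasible_zero_iff.1 hf
    have hdec := frobSq_correction hA (isUnit_negAug X'.toRows₂) hf2
    -- Compared with the candidate `Y₀`, of value `S`: the trace term alone is at least `S`, so it
    -- equals `S` and both squares vanish.
    have h0 := hmin _ _ _ (hcand Y₀ hY₀B)
    rw [hval, hS₀, ← frobSq_fromCols, hdec] at h0
    have h1 := frobSq_nonneg (fromCols ΔA ΔB - fromCols ΔA ΔB * colProj (negAug X'.toRows₂))
    have h2 := frobSq_nonneg (A₂₁ * ((X'.toRows₁ + regr A₂₁ C * negAug X'.toRows₂) *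
      (((negAug X'.toRows₂)ᵀ * negAug X'.toRows₂)⁻¹ * (negAug X'.toRows₂)ᵀ)))
    have h3 := hlow _ hf1
    refine ⟨heq _ hf1 (by linarith), ?_⟩
    have h4 := frobSq_eq_zero (le_antisymm (by linarith) h2)
    -- Multiplication by `V = negAug X'.toRows₂` cancels its left inverse `(Vᵀ V)⁻¹ Vᵀ`.
    have h5 : A₂₁ * (X'.toRows₁ + regr A₂₁ C * negAug X'.toRows₂) = 0 := by
      have := congrArg (· * negAug X'.toRows₂) h4
      simp only [Matrix.zero_mul, Matrix.mul_assoc] at this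
      rwa [nonsing_inv_mul _ ((isUnit_iff_isUnit_det _).1 (isUnit_negAug X'.toRows₂)),
        Matrix.mul_one] at this
    have h6 : X'.toRows₁ + regr A₂₁ C * negAug X'.toRows₂ = 0 := by
      rw [← Matrix.one_mul (X'.toRows₁ + _),
        ← nonsing_inv_mul _ ((isUnit_iff_isUnit_det _).1 hA), Matrix.mul_assoc, Matrix.mul_assoc,
        h5, Matrix.mul_zero, Matrix.mul_zero]
    exact eq_neg_of_add_eq_zero_left h6
  · rintro ⟨h2, h1⟩
    have hX' : X' = fromRows (-(regr A₂₁ C * negAug Y₀)) Y₀ := by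
      rw [← fromRows_toRows X', h1, h2]
    refine ⟨_, _, hX' ▸ hcand Y₀ hY₀B, fun X'' ΔA ΔB hf => ?_⟩
    obtain ⟨hf1, hf2⟩ := feasible_zero_iff.1 hf
    rw [hval, hS₀, ← frobSq_fromCols, frobSq_correction hA (isUnit_negAug X''.toRows₂) hf2]
    have := hlow _ hf1
    have h1 := frobSq_nonneg (fromCols ΔA ΔB - fromCols ΔA ΔB * colProj (negAug X''.toRows₂))
    have h2 := frobSq_nonneg (A₂₁ * ((X''.toRows₁ + regr A₂₁ C * negAug X''.toRows₂) *
      (((negAug X''.toRows₂)ᵀ * negAug X''.toRows₂)⁻¹ * (negAug X''.toRows₂)ᵀ)))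
    linarith

/-- If there is a gap after the `l` smallest Ritz values, then the quotient of the blocks of a
Ritz matrix does not depend on the choice of the Ritz vectors. -/
theorem IsRitzMatrix.quotient_eq {p : Type*} [Fintype p]
    {G : Matrix (p ⊕ Fin l) (p ⊕ Fin l) ℝ}
    {P : Matrix (p ⊕ Fin l) (Fin (l + d)) ℝ} {Z : Matrix (p ⊕ Fin l) (Fin l) ℝ}
    (h : IsRitzMatrix G P Z) {W : Matrix (Fin (l + d)) (Fin (l + d)) ℝ} {θ : Fin (l + d) → ℝ}
    (hW : IsEigenDecomposition (Pᵀ * G * P) W θ) {a b : ℝ}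
    (hab : a < b) (ha : ∀ i, θ (Fin.castAdd d i) ≤ a) (hb : ∀ i, b ≤ θ (Fin.natAdd l i))
    (hZ : IsUnit (P * lowCols d W).toRows₂) :
    IsUnit Z.toRows₂ ∧ Z.toRows₁ * Z.toRows₂⁻¹ =
      (P * lowCols d W).toRows₁ * (P * lowCols d W).toRows₂⁻¹ := by
  obtain ⟨W', θ', hmono, horth, heig, rfl⟩ := h
  have hW' : IsEigenDecomposition (Pᵀ * G * P) W' θ' := ⟨hmono, horth, heig⟩
  -- Both decompositions minimize the trace, so the gap forces equal low spans; the bases differ by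
  -- an orthogonal `K`, which cancels in the quotient.
  have hle : (lowProj d W' * (Pᵀ * G * P)).trace ≤ ∑ i, θ (Fin.castAdd d i) := by
    rw [hW'.trace_lowProj_mul, ← hW.trace_lowProj_mul]
    exact hW'.sum_low_le (lowProj_transpose W) hW.lowProj_mul_self hW.trace_lowProj
  have h1 := hW.eq_of_trace_le hab ha hb (lowProj_transpose W') hW'.lowProj_mul_self
    hW'.trace_lowProj hle
  have h2 : lowCols d W' = lowCols d W * ((lowCols d W)ᵀ * lowCols d W') := by
    have := congrArg (· * lowCols d W') h1
    simp only [lowProj, Matrix.mul_assoc, hW'.low_orthonormal, Matrix.mul_one] at this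
    exact this.symm
  set K := (lowCols d W)ᵀ * lowCols d W' with hK
  have hKK : Kᵀ * K = 1 := by
    rw [hK, transpose_mul, transpose_transpose, Matrix.mul_assoc, ← hK, ← h2, hW'.low_orthonormal]
  have hKu : IsUnit K.det := (isUnit_iff_isUnit_det _).1 (IsUnit.of_mul_eq_one_right _ hKK)
  have hZK : (P * W').submatrix id (Fin.castAdd d) = P * lowCols d W * K := by
    change lowCols d (P * W') = _
    rw [lowCols_mul, h2, Matrix.mul_assoc]
  have hr1 : (P * lowCols d W * K).toRows₁ = (P * lowCols d W).toRows₁ * K := rfl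
  have hr2 : (P * lowCols d W * K).toRows₂ = (P * lowCols d W).toRows₂ * K := rfl
  rw [hZK, hr1, hr2]
  refine ⟨hZ.mul ((isUnit_iff_isUnit_det _).2 hKu), ?_⟩
  rw [Matrix.mul_inv_rev, Matrix.mul_assoc, ← Matrix.mul_assoc K, mul_nonsing_inv _ hKu,
    Matrix.one_mul]

end Solution

/-! ### Limits of matrices -/

section Limits

variable {ι κ lam α : Type*} {F : Filter α}

theorem tendsto_matrix {A : α → Matrix ι κ ℝ} {B : Matrix ι κ ℝ} :
    Tendsto A F (𝓝 B) ↔ ∀ i j, Tendsto (fun m => A m i j) F (𝓝 (B i j)) :=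
  tendsto_pi_nhds.trans (forall_congr' fun _ => tendsto_pi_nhds)

theorem tendsto_matrix_mul [Fintype κ] {A : α → Matrix ι κ ℝ} {B : α → Matrix κ lam ℝ}
    {A₀ : Matrix ι κ ℝ} {B₀ : Matrix κ lam ℝ} (hA : Tendsto A F (𝓝 A₀))
    (hB : Tendsto B F (𝓝 B₀)) : Tendsto (fun m => A m * B m) F (𝓝 (A₀ * B₀)) :=
  ((continuous_fst.matrix_mul continuous_snd).tendsto (A₀, B₀)).comp (hA.prodMk_nhds hB)

theorem tendsto_matrix_transpose {A : α → Matrix ι κ ℝ} {A₀ : Matrix ι κ ℝ}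
    (hA : Tendsto A F (𝓝 A₀)) : Tendsto (fun m => (A m)ᵀ) F (𝓝 A₀ᵀ) :=
  (continuous_id.matrix_transpose.tendsto A₀).comp hA

theorem tendsto_matrix_trace [Fintype ι] {A : α → Matrix ι ι ℝ} {A₀ : Matrix ι ι ℝ}
    (hA : Tendsto A F (𝓝 A₀)) : Tendsto (fun m => (A m).trace) F (𝓝 A₀.trace) :=
  (continuous_id.matrix_trace.tendsto A₀).comp hA

theorem tendsto_matrix_inv [Fintype ι] [DecidableEq ι] {A : α → Matrix ι ι ℝ} {A₀ : Matrix ι ι ℝ}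
    (hA : Tendsto A F (𝓝 A₀)) (h : IsUnit A₀) : Tendsto (fun m => (A m)⁻¹) F (𝓝 A₀⁻¹) := by
  refine (continuousAt_matrix_inv A₀ ?_).tendsto.comp hA
  have h0 : A₀.det ≠ 0 := ((isUnit_iff_isUnit_det _).1 h).ne_zero
  rw [Ring.inverse_eq_inv']
  exact continuousAt_inv₀ h0

theorem eventually_isUnit_matrix [Fintype ι] [DecidableEq ι] {A : α → Matrix ι ι ℝ}
    {A₀ : Matrix ι ι ℝ} (hA : Tendsto A F (𝓝 A₀)) (h : IsUnit A₀) : ∀ᶠ m in F, IsUnit (A m) := by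
  have h0 : A₀.det ≠ 0 := ((isUnit_iff_isUnit_det _).1 h).ne_zero
  have := ((continuous_id.matrix_det.tendsto A₀).comp hA).eventually_ne h0
  filter_upwards [this] with m hm
  exact (isUnit_iff_isUnit_det _).2 (isUnit_iff_ne_zero.2 hm)

/-- Eigenvector matrices need not converge; only the boundedness of their entries is available. -/
theorem tendsto_bdd_matrix_mul_zero [Fintype κ] {A : α → Matrix ι κ ℝ} {B : α → Matrix κ lam ℝ}
    (hA : ∀ m i j, |A m i j| ≤ 1) (hB : Tendsto B F (𝓝 0)) :
    Tendsto (fun m => A m * B m) F (𝓝 0) := by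
  rw [tendsto_matrix] at hB ⊢
  intro i j
  simp only [Matrix.mul_apply, Matrix.zero_apply]
  rw [← Finset.sum_const_zero (s := (Finset.univ : Finset κ))]
  refine tendsto_finsetSum _ fun k _ => ?_
  exact bdd_le_mul_tendsto_zero' 1 (Eventually.of_forall fun m => hA m i k) (hB k j)

theorem tendsto_of_frobSq_sub [Fintype ι] [Fintype κ] {A : α → Matrix ι κ ℝ} {A₀ : Matrix ι κ ℝ}
    (h : Tendsto (fun m => frobSq (A m - A₀)) F (𝓝 0)) : Tendsto A F (𝓝 A₀) := by
  rw [tendsto_matrix]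
  intro i j
  rw [tendsto_iff_dist_tendsto_zero]
  have h1 := (Real.continuous_sqrt.tendsto 0).comp h
  rw [Real.sqrt_zero] at h1
  refine squeeze_zero (fun _ => dist_nonneg) (fun m => ?_) h1
  rw [Real.dist_eq]
  refine Real.abs_le_sqrt ?_
  refine le_trans (Finset.single_le_sum (f := fun c => (A m - A₀) i c ^ 2)
    (fun c _ => sq_nonneg _) (Finset.mem_univ j)) ?_
  exact Finset.single_le_sum (f := fun i => ∑ c, (A m - A₀) i c ^ 2)
    (fun c _ => Finset.sum_nonneg fun _ _ => sq_nonneg _) (Finset.mem_univ i)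

end Limits

theorem abs_le_one_of_orthonormal {ι κ : Type*} [Fintype ι] [DecidableEq κ] {W : Matrix ι κ ℝ}
    (h : Wᵀ * W = 1) (i : ι) (j : κ) : |W i j| ≤ 1 := by
  have h1 := congrFun (congrFun h j) j
  rw [Matrix.mul_apply, one_apply_eq] at h1
  rw [abs_le_one_iff_mul_self_le_one, ← h1]
  exact Finset.single_le_sum (f := fun k => Wᵀ j k * W k j) (fun k _ => mul_self_nonneg (W k j))
    (Finset.mem_univ i)

theorem abs_le_one_of_proj {ι : Type*} [Fintype ι] {Q : Matrix ι ι ℝ} (hQ : Qᵀ = Q)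
    (hQQ : Q * Q = Q) (i j : ι) : |Q i j| ≤ 1 := by
  have h1 : Q j j = ∑ k, Q k j * Q k j := by
    conv_lhs => rw [← hQQ, Matrix.mul_apply]
    exact Finset.sum_congr rfl fun k _ => by rw [show Q j k = Q k j from congrFun (congrFun hQ k) j]
  rw [abs_le_one_iff_mul_self_le_one]
  refine le_trans ?_ (diag_nonneg_of_proj hQ hQQ j).2.1
  rw [h1]
  exact Finset.single_le_sum (f := fun k => Q k j * Q k j) (fun k _ => mul_self_nonneg (Q k j))
    (Finset.mem_univ i)

/-! ### Perturbation of the low spectral subspace -/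

section Spectral

variable {l d : ℕ} {T W₀ : Matrix (Fin (l + d)) (Fin (l + d)) ℝ} {θ₀ : Fin (l + d) → ℝ}

theorem IsEigenDecomposition.high_orthonormal (h : IsEigenDecomposition T W₀ θ₀) :
    (highCols l W₀)ᵀ * highCols l W₀ = 1 := by
  ext i j
  have := congrFun (congrFun h.orthogonal (Fin.natAdd l i)) (Fin.natAdd l j)
  simp only [Matrix.mul_apply, transpose_apply, one_apply, Fin.natAdd_inj] at this
  simpa [highCols, Matrix.mul_apply, one_apply] using this

/-- The eigenvalues of a positive semidefinite matrix of rank `d`. -/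
theorem IsEigenDecomposition.of_rank (h : IsEigenDecomposition T W₀ θ₀) (hrank : T.rank = d)
    (hpos : ∀ i, 0 ≤ θ₀ i) :
    (∀ i, θ₀ (Fin.castAdd d i) = 0) ∧ ∃ δ > 0, ∀ i, δ ≤ θ₀ (Fin.natAdd l i) := by
  have hcard : (Finset.univ.filter fun i => θ₀ i ≠ 0).card = d := by
    have h1 : IsUnit W₀.det :=
      (isUnit_iff_isUnit_det _).1 (IsUnit.of_mul_eq_one_right _ h.orthogonal)
    rw [h.eq, rank_mul_eq_left_of_isUnit_det _ _ (by rwa [det_transpose]),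
      rank_mul_eq_right_of_isUnit_det _ _ h1, rank_diagonal, Fintype.card_subtype] at hrank
    exact hrank
  -- Exactly `d` eigenvalues are nonzero. A vanishing high one would force all earlier ones to
  -- vanish, leaving fewer than `d`; a nonzero low one would give more than `d`.
  have hnz : ∀ i, 0 < θ₀ (Fin.natAdd l i) := by
    intro i
    refine lt_of_le_of_ne (hpos _) fun h0 => ?_
    have hsub : (Finset.univ.filter fun i => θ₀ i ≠ 0) ⊆ Finset.Ioi (Fin.natAdd l i) := by
      intro k hk
      rw [Finset.mem_Ioi]
      by_contra hle
      exact (Finset.mem_filter.1 hk).2 (le_antisymm ((h.monotone (not_lt.1 hle)).trans h0.ge)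
        (hpos k))
    have := Finset.card_le_card hsub
    rw [hcard, Fin.card_Ioi, Fin.val_natAdd] at this
    have := i.2
    omega
  refine ⟨fun i => ?_, ?_⟩
  · by_contra h0
    have hlt := lt_of_le_of_ne (hpos _) (Ne.symm h0)
    have hsub : Finset.Ici (Fin.castAdd d i) ⊆ Finset.univ.filter fun i => θ₀ i ≠ 0 := by
      intro k hk
      exact Finset.mem_filter.2 ⟨Finset.mem_univ _,
        (hlt.trans_le (h.monotone (Finset.mem_Ici.1 hk))).ne'⟩
    have := Finset.card_le_card hsub
    rw [hcard, Fin.card_Ici, Fin.val_castAdd] at this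
    have := i.2
    omega
  · rcases Nat.eq_zero_or_pos d with rfl | hd
    · exact ⟨1, one_pos, fun i => i.elim0⟩
    · exact ⟨_, hnz ⟨0, hd⟩, fun i => h.monotone (by simp [Fin.le_def])⟩

variable {t : ℕ → Matrix (Fin (l + d)) (Fin (l + d)) ℝ}
  {W : ℕ → Matrix (Fin (l + d)) (Fin (l + d)) ℝ} {θ : ℕ → Fin (l + d) → ℝ} {δ : ℝ}

/-- Continuity of the spectral projection belonging to the `l` smallest eigenvalues. -/
theorem tendsto_lowProj (h₀ : IsEigenDecomposition T W₀ θ₀) (hlow : ∀ i, θ₀ (Fin.castAdd d i) = 0)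
    (hδ : 0 < δ) (hhigh : ∀ i, δ ≤ θ₀ (Fin.natAdd l i)) (ht : Tendsto t atTop (𝓝 T))
    (h : ∀ m, IsEigenDecomposition (t m) (W m) (θ m)) :
    Tendsto (fun m => lowProj d (W m)) atTop (𝓝 (lowProj d W₀)) := by
  have hQQ₀ := h₀.lowProj_mul_self
  have hQQ : ∀ m, lowProj d (W m) * lowProj d (W m) = lowProj d (W m) := fun m =>
    (h m).lowProj_mul_self
  -- For projections of equal trace `l`, the distance is governed by the trace of the product. Ky
  -- Fan for `T` bounds this defect by `tr (lowProj d (W m) * T) / δ`, and minimality for `t m`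
  -- makes that small.
  have hfrob : ∀ m, frobSq (lowProj d (W m) - lowProj d W₀)
      = 2 * (l - (lowProj d (W m) * lowProj d W₀).trace) := by
    intro m
    rw [frobSq_eq_trace, transpose_sub, lowProj_transpose, lowProj_transpose, Matrix.sub_mul,
      Matrix.mul_sub, Matrix.mul_sub, hQQ, hQQ₀, trace_sub, trace_sub, trace_sub,
      (h m).trace_lowProj, h₀.trace_lowProj, trace_mul_comm (lowProj d W₀)]
    ring
  have hky : ∀ m, δ * (l - (lowProj d (W m) * lowProj d W₀).trace)
      ≤ (lowProj d (W m) * T).trace := by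
    intro m
    have h1 := h₀.ky_fan (fun i => (hlow i).le) hhigh (lowProj_transpose (W m)) (hQQ m)
      (h m).trace_lowProj
    have h2 : ∑ i, (W₀ᵀ * lowProj d (W m) * W₀) (Fin.natAdd l i) (Fin.natAdd l i)
        = l - (lowProj d (W m) * lowProj d W₀).trace := by
      have h3 : highCols l W₀ * (highCols l W₀)ᵀ = 1 - lowProj d W₀ :=
        eq_sub_of_add_eq' h₀.low_add_high
      have h4 : ∑ i, (W₀ᵀ * lowProj d (W m) * W₀) (Fin.natAdd l i) (Fin.natAdd l i)
          = ((highCols l W₀)ᵀ * lowProj d (W m) * highCols l W₀).trace := rfl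
      rw [h4, trace_mul_comm, ← Matrix.mul_assoc, h3, trace_mul_comm, Matrix.mul_sub,
        Matrix.mul_one, trace_sub, (h m).trace_lowProj]
    rw [h2] at h1
    simpa [hlow] using h1
  have hle : ∀ m, (lowProj d (W m) * T).trace
      ≤ (lowProj d W₀ * t m).trace + (lowProj d (W m) * (T - t m)).trace := by
    intro m
    have h1 := (h m).sum_low_le (lowProj_transpose W₀) hQQ₀ h₀.trace_lowProj
    rw [← (h m).trace_lowProj_mul] at h1
    rw [Matrix.mul_sub, trace_sub]
    linarith
  have hlim : Tendsto (fun m => (lowProj d W₀ * t m).trace + (lowProj d (W m) * (T - t m)).trace)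
      atTop (𝓝 0) := by
    have h1 := tendsto_matrix_trace (tendsto_matrix_mul
      (tendsto_const_nhds (x := lowProj d W₀)) ht)
    rw [h₀.trace_lowProj_mul, Finset.sum_eq_zero fun i _ => hlow i] at h1
    have h2 : Tendsto (fun m => T - t m) atTop (𝓝 0) := by
      simpa using (tendsto_const_nhds (x := T)).sub ht
    have h3 := tendsto_matrix_trace (tendsto_bdd_matrix_mul_zero
      (fun m => abs_le_one_of_proj (lowProj_transpose (W m)) (hQQ m)) h2)
    rw [trace_zero] at h3
    simpa using h1.add h3
  refine tendsto_of_frobSq_sub (squeeze_zero (fun _ => frobSq_nonneg _) (fun m => ?_)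
    (by simpa using hlim.const_mul (2 / δ)))
  rw [hfrob, div_mul_eq_mul_div, le_div_iff₀ hδ]
  linarith [hky m, hle m]

/-- The gap in the spectrum persists under small perturbations. -/
theorem eventually_gap (h₀ : IsEigenDecomposition T W₀ θ₀) (hlow : ∀ i, θ₀ (Fin.castAdd d i) = 0)
    (hδ : 0 < δ) (hhigh : ∀ i, δ ≤ θ₀ (Fin.natAdd l i)) (ht : Tendsto t atTop (𝓝 T))
    (h : ∀ m, IsEigenDecomposition (t m) (W m) (θ m)) :
    ∀ᶠ m in atTop, (∀ i, θ m (Fin.castAdd d i) ≤ δ / 3) ∧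
      ∀ i, 2 * δ / 3 ≤ θ m (Fin.natAdd l i) := by
  have hQ := tendsto_lowProj h₀ hlow hδ hhigh ht h
  -- compression of a null sequence
  have hcomp : ∀ {κ : Type} [Fintype κ] [DecidableEq κ] {U : ℕ → Matrix (Fin (l + d)) κ ℝ}
      {x : ℕ → Matrix (Fin (l + d)) (Fin (l + d)) ℝ}, (∀ m, (U m)ᵀ * U m = 1) →
      Tendsto x atTop (𝓝 0) → Tendsto (fun m => (U m)ᵀ * x m * U m) atTop (𝓝 0) := by
    intro κ _ _ U x hU hx
    have hb : ∀ m i j, |(U m)ᵀ i j| ≤ 1 := fun m i j => abs_le_one_of_orthonormal (hU m) j i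
    have h1 := tendsto_matrix_transpose (tendsto_bdd_matrix_mul_zero hb hx)
    have h2 := tendsto_matrix_transpose (tendsto_bdd_matrix_mul_zero hb h1)
    simpa [Matrix.mul_assoc] using h2
  -- The low eigenvalues form the compression of `t m * lowProj d (W m)`, which tends to `T *
  -- lowProj d W₀ = 0`.
  have h1 : Tendsto (fun m => (lowCols d (W m))ᵀ * (t m * lowProj d (W m)) * lowCols d (W m))
      atTop (𝓝 0) := by
    refine hcomp (fun m => (h m).low_orthonormal) ?_
    have : T * lowProj d W₀ = 0 := by
      rw [lowProj, ← Matrix.mul_assoc, h₀.mul_low]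
      simp [hlow]
    exact this ▸ tendsto_matrix_mul ht hQ
  -- Adding `δ • lowProj` is invisible to the high columns of `W m`, but its limit satisfies `T + δ
  -- • lowProj d W₀ ≥ δ I`. Hence the high eigenvalues are at least `δ - δ / 3` eventually.
  have h2 : Tendsto (fun m => (highCols l (W m))ᵀ *
      (t m + δ • lowProj d (W m) - (T + δ • lowProj d W₀)) * highCols l (W m)) atTop (𝓝 0) := by
    refine hcomp (fun m => (h m).high_orthonormal) ?_
    simpa using (ht.add (hQ.const_smul δ)).sub (tendsto_const_nhds (x := T + δ • lowProj d W₀))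
  have e1 : ∀ i, ∀ᶠ m in atTop, θ m (Fin.castAdd d i) ≤ δ / 3 := by
    intro i
    have h3 := (tendsto_matrix.1 h1 i i).eventually_le_const (show (0 : ℝ) < δ / 3 by positivity)
    filter_upwards [h3] with m hm
    have : (lowCols d (W m))ᵀ * (t m * lowProj d (W m)) * lowCols d (W m)
        = diagonal fun i => θ m (Fin.castAdd d i) := by
      rw [lowProj, ← Matrix.mul_assoc (t m), (h m).mul_low, Matrix.mul_assoc, Matrix.mul_assoc,
        Matrix.mul_assoc, (h m).low_orthonormal, Matrix.mul_one, ← Matrix.mul_assoc,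
        (h m).low_orthonormal, Matrix.one_mul]
    rwa [this, diagonal_apply_eq] at hm
  have e2 : ∀ i, ∀ᶠ m in atTop, 2 * δ / 3 ≤ θ m (Fin.natAdd l i) := by
    intro i
    have h3 := (tendsto_matrix.1 h2 i i).eventually_const_le
      (show -(δ / 3) < (0 : ℝ) by linarith)
    filter_upwards [h3] with m hm
    have hz : (highCols l (W m))ᵀ * lowProj d (W m) * highCols l (W m) = 0 := by
      rw [lowProj, ← Matrix.mul_assoc, (h m).high_mul_low, Matrix.zero_mul, Matrix.zero_mul]
    have h4 : (highCols l (W m))ᵀ * (t m + δ • lowProj d (W m)) * highCols l (W m)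
        = diagonal fun i => θ m (Fin.natAdd l i) := by
      rw [Matrix.mul_add, Matrix.add_mul, Matrix.mul_smul, Matrix.smul_mul, hz, smul_zero, add_zero,
        Matrix.mul_assoc, (h m).mul_high, ← Matrix.mul_assoc, (h m).high_orthonormal,
        Matrix.one_mul]
    set V := (highCols l W₀)ᵀ * highCols l (W m) with hV
    have h5 : (highCols l (W m))ᵀ * (T + δ • lowProj d W₀) * highCols l (W m)
        = Vᵀ * (diagonal fun i => θ₀ (Fin.natAdd l i) - δ) * V + δ • 1 := by
      have hT : T = highCols l W₀ * (diagonal fun i => θ₀ (Fin.natAdd l i))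
          * (highCols l W₀)ᵀ := by
        rw [← h₀.mul_high, Matrix.mul_assoc, eq_sub_of_add_eq' h₀.low_add_high, Matrix.mul_sub,
          Matrix.mul_one, ← Matrix.mul_assoc, h₀.mul_low]
        simp [hlow]
      have hX : T + δ • lowProj d W₀ = highCols l W₀ * (diagonal fun i => θ₀ (Fin.natAdd l i) - δ)
          * (highCols l W₀)ᵀ + δ • 1 := by
        have hd : (diagonal fun i => θ₀ (Fin.natAdd l i) - δ)
            = (diagonal fun i => θ₀ (Fin.natAdd l i)) - δ • (1 : Matrix (Fin d) (Fin d) ℝ) := by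
          rw [← diagonal_one, ← diagonal_smul, diagonal_sub]
          simp
        rw [hd, Matrix.mul_sub, Matrix.sub_mul, ← hT, ← h₀.low_add_high, Matrix.mul_smul,
          Matrix.smul_mul, Matrix.mul_one, smul_add, lowProj]
        abel
      rw [hX, Matrix.mul_add, Matrix.add_mul, Matrix.mul_smul, Matrix.smul_mul, Matrix.mul_one,
        (h m).high_orthonormal, hV, transpose_mul, transpose_transpose]
      simp only [Matrix.mul_assoc]
    have h6 : 0 ≤ (Vᵀ * (diagonal fun i => θ₀ (Fin.natAdd l i) - δ) * V) i i := by
      rw [Matrix.mul_apply]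
      refine Finset.sum_nonneg fun k _ => ?_
      rw [mul_diagonal, transpose_apply, mul_right_comm]
      exact mul_nonneg (mul_self_nonneg _) (sub_nonneg.2 (hhigh k))
    rw [Matrix.mul_sub, Matrix.sub_mul, h4, h5, Matrix.sub_apply, Matrix.add_apply, diagonal_apply_eq,
      Matrix.smul_apply,
      one_apply_eq, smul_eq_mul] at hm
    linarith
  exact (eventually_all.2 e1).and (eventually_all.2 e2)

end Spectral

/-! ### From the subspace to the quotient of blocks -/

section Quotient

variable {l d : ℕ} {p : Type*}

/-- The quotient of the blocks of a basis of a subspace is determined by the projection. -/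
theorem quotient_eq_proj {Z : Matrix (p ⊕ Fin l) (Fin l) ℝ} (hZ : IsUnit Z.toRows₂) :
    Z.toRows₁ * Z.toRows₂⁻¹ = (Z * Zᵀ).submatrix Sum.inl Sum.inr *
      ((Z * Zᵀ).submatrix Sum.inr Sum.inr)⁻¹ := by
  have h1 : (Z * Zᵀ).submatrix Sum.inl Sum.inr = Z.toRows₁ * Z.toRows₂ᵀ := rfl
  have h2 : (Z * Zᵀ).submatrix Sum.inr Sum.inr = Z.toRows₂ * Z.toRows₂ᵀ := rfl
  have h3 := (isUnit_iff_isUnit_det _).1 hZ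
  rw [h1, h2, Matrix.mul_inv_rev, Matrix.mul_assoc, ← Matrix.mul_assoc Z.toRows₂ᵀ,
    mul_nonsing_inv _ (by rwa [det_transpose]), Matrix.one_mul]

theorem isUnit_proj_iff {Z : Matrix (p ⊕ Fin l) (Fin l) ℝ} :
    IsUnit ((Z * Zᵀ).submatrix Sum.inr Sum.inr) ↔ IsUnit Z.toRows₂ := by
  have h2 : (Z * Zᵀ).submatrix Sum.inr Sum.inr = Z.toRows₂ * Z.toRows₂ᵀ := rfl
  rw [h2, isUnit_iff_isUnit_det, isUnit_iff_isUnit_det, det_mul, det_transpose]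
  simp

/-- The quotient depends only on the projection onto the span of `P * lowCols d (W m)`, so no
consistent choice of eigenvectors is needed. -/
theorem tendsto_quotient {W : ℕ → Matrix (Fin (l + d)) (Fin (l + d)) ℝ}
    {W₀ : Matrix (Fin (l + d)) (Fin (l + d)) ℝ} {P : Matrix (p ⊕ Fin l) (Fin (l + d)) ℝ}
    (h : Tendsto (fun m => lowProj d (W m)) atTop (𝓝 (lowProj d W₀)))
    (hZ : IsUnit (P * lowCols d W₀).toRows₂) :
    (∀ᶠ m in atTop, IsUnit (P * lowCols d (W m)).toRows₂) ∧
    Tendsto (fun m => (P * lowCols d (W m)).toRows₁ * (P * lowCols d (W m)).toRows₂⁻¹) atTop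
      (𝓝 ((P * lowCols d W₀).toRows₁ * (P * lowCols d W₀).toRows₂⁻¹)) := by
  have hPQ : ∀ W : Matrix (Fin (l + d)) (Fin (l + d)) ℝ,
      (P * lowCols d W) * (P * lowCols d W)ᵀ = P * lowProj d W * Pᵀ := fun W => by
    rw [transpose_mul, lowProj]
    simp only [Matrix.mul_assoc]
  have hlim : Tendsto (fun m => (P * lowCols d (W m)) * (P * lowCols d (W m))ᵀ) atTop
      (𝓝 ((P * lowCols d W₀) * (P * lowCols d W₀)ᵀ)) := by
    simp only [hPQ]
    exact tendsto_matrix_mul (tendsto_matrix_mul tendsto_const_nhds h) tendsto_const_nhds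
  have h12 := ((continuous_id.matrix_submatrix Sum.inl Sum.inr).tendsto _).comp hlim
  have h22 := ((continuous_id.matrix_submatrix Sum.inr Sum.inr).tendsto _).comp hlim
  have hev := eventually_isUnit_matrix h22 (isUnit_proj_iff.2 hZ)
  simp only [Function.comp_apply, id, isUnit_proj_iff] at hev
  refine ⟨hev, ?_⟩
  rw [quotient_eq_proj hZ]
  refine (tendsto_matrix_mul h12 (tendsto_matrix_inv h22 (isUnit_proj_iff.2 hZ))).congr' ?_
  filter_upwards [hev] with m hm
  rw [quotient_eq_proj hm]
  rfl

/-- The eigenvectors for the smallest eigenvalue `0` span the column space of `Pᵀ [Y; -I]`. -/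
theorem quotient_eq_of_null {q : ℕ} {T W₀ : Matrix (Fin (l + d)) (Fin (l + d)) ℝ}
    {θ₀ : Fin (l + d) → ℝ} (h₀ : IsEigenDecomposition T W₀ θ₀)
    (hhigh : ∀ i, 0 < θ₀ (Fin.natAdd l i)) {P : Matrix (Fin q ⊕ Fin l) (Fin (l + d)) ℝ}
    {Y : Matrix (Fin q) (Fin l) ℝ} (hPY : P * (Pᵀ * negAug Y) = negAug Y)
    (hT : T * (Pᵀ * negAug Y) = 0) (hsymm : Tᵀ = T) :
    IsUnit (P * lowCols d W₀).toRows₂ ∧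
      Y = -((P * lowCols d W₀).toRows₁ * (P * lowCols d W₀).toRows₂⁻¹) := by
  set V := Pᵀ * negAug Y with hV
  -- A null vector of `T` is orthogonal to the eigenvectors with positive eigenvalue, so `V` lies in
  -- the low span.
  have h1 : (highCols l W₀)ᵀ * V = 0 := by
    have h2 : (diagonal fun i => θ₀ (Fin.natAdd l i)) * ((highCols l W₀)ᵀ * V) = 0 := by
      have := congrArg transpose h₀.mul_high
      rw [transpose_mul, transpose_mul, hsymm, diagonal_transpose] at this
      rw [← Matrix.mul_assoc, ← this, Matrix.mul_assoc, hT, Matrix.mul_zero]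
    ext i j
    have := congrFun (congrFun h2 i) j
    rw [diagonal_mul, Matrix.zero_apply] at this
    exact (mul_eq_zero.1 this).resolve_left (hhigh i).ne'
  have h2 : V = lowCols d W₀ * ((lowCols d W₀)ᵀ * V) := by
    conv_lhs => rw [← Matrix.one_mul V, ← h₀.low_add_high, Matrix.add_mul, Matrix.mul_assoc,
      Matrix.mul_assoc, h1, Matrix.mul_zero, add_zero]
  set K := (lowCols d W₀)ᵀ * V with hK
  set Z := P * lowCols d W₀ with hZ
  have h3 : negAug Y = Z * K := by rw [← hPY, h2, ← Matrix.mul_assoc]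
  rw [negAug, ← fromRows_toRows Z, fromRows_mul, fromRows_ext_iff] at h3
  have h4 : Z.toRows₂ * -K = 1 := by rw [Matrix.mul_neg, ← h3.2, neg_neg]
  refine ⟨IsUnit.of_mul_eq_one _ h4, ?_⟩
  rw [inv_eq_right_inv h4, Matrix.mul_neg, neg_neg, ← h3.1]

end Quotient

/-! ### Limits of regression coefficients and Gram matrices -/

section GramLimits

variable {ι : ℕ → Type*} [∀ m, Fintype (ι m)] {κ ν π : Type*} [Fintype κ] [DecidableEq κ]
  {r : ℕ → ℝ} {A : (m : ℕ) → Matrix (ι m) κ ℝ} {S₁₁ : Matrix κ κ ℝ}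

theorem regr_add {ι : Type*} [Fintype ι] (A : Matrix ι κ ℝ) (C D : Matrix ι ν ℝ) :
    regr A (C + D) = regr A C + regr A D := by
  simp only [regr, Matrix.mul_add]

theorem regr_mul {ι : Type*} [Fintype ι] [Fintype ν] (A : Matrix ι κ ℝ) (C : Matrix ι ν ℝ)
    (P : Matrix ν π ℝ) : regr A (C * P) = regr A C * P := by
  simp only [regr, Matrix.mul_assoc]

theorem gram_eq_regr {ι : Type*} [Fintype ι] (A : Matrix ι κ ℝ) (C : Matrix ι ν ℝ) :
    gram A C = Cᵀ * C - Cᵀ * A * regr A C := by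
  simp only [gram, regr, Matrix.mul_assoc]

theorem gram_mul {ι : Type*} [Fintype ι] [Fintype ν] (A : Matrix ι κ ℝ) (C : Matrix ι ν ℝ)
    (P : Matrix ν π ℝ) : gram A (C * P) = Pᵀ * gram A C * P := by
  simp only [gram, transpose_mul, Matrix.mul_sub, Matrix.sub_mul, Matrix.mul_assoc]

theorem eventually_isUnit_transpose_mul_self
    (hA : Tendsto (fun m => r m • ((A m)ᵀ * A m)) atTop (𝓝 S₁₁)) (hS : IsUnit S₁₁) :
    ∀ᶠ m in atTop, IsUnit ((A m)ᵀ * A m) := by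
  filter_upwards [eventually_isUnit_matrix hA hS] with m hm
  rw [isUnit_iff_isUnit_det, det_smul] at hm
  exact (isUnit_iff_isUnit_det _).2 (isUnit_of_mul_isUnit_right hm)

/-- The normalization `r m` cancels between the inverse and the right factor. -/
theorem tendsto_regr {C : (m : ℕ) → Matrix (ι m) ν ℝ} {S₁₂ : Matrix κ ν ℝ}
    (hA : Tendsto (fun m => r m • ((A m)ᵀ * A m)) atTop (𝓝 S₁₁)) (hS : IsUnit S₁₁)
    (hC : Tendsto (fun m => r m • ((A m)ᵀ * C m)) atTop (𝓝 S₁₂)) :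
    Tendsto (fun m => regr (A m) (C m)) atTop (𝓝 (S₁₁⁻¹ * S₁₂)) := by
  refine (tendsto_matrix_mul (tendsto_matrix_inv hA hS) hC).congr' ?_
  filter_upwards [eventually_isUnit_matrix hA hS, eventually_isUnit_transpose_mul_self hA hS]
    with m hm hm'
  rw [← transpose_mul_regr hm' (C m), ← Matrix.smul_mul (r m) ((A m)ᵀ * A m),
    ← Matrix.mul_assoc, nonsing_inv_mul _ ((isUnit_iff_isUnit_det _).1 hm), Matrix.one_mul]

theorem tendsto_transpose_mul_swap {ν' : Type*} {C : (m : ℕ) → Matrix (ι m) ν ℝ}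
    {D : (m : ℕ) → Matrix (ι m) ν' ℝ} {S : Matrix ν ν' ℝ}
    (h : Tendsto (fun m => r m • ((C m)ᵀ * D m)) atTop (𝓝 S)) :
    Tendsto (fun m => r m • ((D m)ᵀ * C m)) atTop (𝓝 Sᵀ) := by
  simpa only [transpose_smul, transpose_mul, transpose_transpose] using tendsto_matrix_transpose h

/-- The plain second moments are `gram` plus the regression term. They are needed to bound the
weights in the strong law for `c` against the errors. -/
theorem tendsto_transpose_mul_self_of_gram {c : (m : ℕ) → Matrix (ι m) π ℝ} {S : Matrix κ π ℝ}
    {T : Matrix π π ℝ} (hA : Tendsto (fun m => r m • ((A m)ᵀ * A m)) atTop (𝓝 S₁₁))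
    (hS : IsUnit S₁₁) (hc : Tendsto (fun m => r m • ((A m)ᵀ * c m)) atTop (𝓝 S))
    (hT : Tendsto (fun m => r m • gram (A m) (c m)) atTop (𝓝 T)) :
    Tendsto (fun m => r m • ((c m)ᵀ * c m)) atTop (𝓝 (T + Sᵀ * (S₁₁⁻¹ * S))) := by
  refine (hT.add (tendsto_matrix_mul (tendsto_transpose_mul_swap hc)
    (tendsto_regr hA hS hc))).congr fun m => ?_
  rw [gram_eq_regr, Matrix.smul_mul, ← smul_add, sub_add_cancel]

/-- When the Gram matrix is expanded, every term containing `e` vanishes in the limit except `eᵀ e`.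
-/
theorem tendsto_gram_add {c e : (m : ℕ) → Matrix (ι m) π ℝ} {S : Matrix κ π ℝ}
    {T R : Matrix π π ℝ} (hA : Tendsto (fun m => r m • ((A m)ᵀ * A m)) atTop (𝓝 S₁₁))
    (hS : IsUnit S₁₁) (hc : Tendsto (fun m => r m • ((A m)ᵀ * c m)) atTop (𝓝 S))
    (hT : Tendsto (fun m => r m • gram (A m) (c m)) atTop (𝓝 T))
    (hAe : Tendsto (fun m => r m • ((A m)ᵀ * e m)) atTop (𝓝 0))
    (hce : Tendsto (fun m => r m • ((c m)ᵀ * e m)) atTop (𝓝 0))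
    (hee : Tendsto (fun m => r m • ((e m)ᵀ * e m)) atTop (𝓝 R)) :
    Tendsto (fun m => r m • gram (A m) (c m + e m)) atTop (𝓝 (T + R)) := by
  have h1 := tendsto_matrix_mul (tendsto_transpose_mul_swap hc) (tendsto_regr hA hS hAe)
  have h2 := tendsto_matrix_mul (tendsto_transpose_mul_swap hAe)
    ((tendsto_regr hA hS hc).add (tendsto_regr hA hS hAe))
  have h3 := (((hT.add hce).add (tendsto_transpose_mul_swap hce)).add hee).sub (h1.add h2)
  simp only [transpose_zero, Matrix.mul_zero, Matrix.zero_mul, add_zero, sub_zero] at h3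
  refine h3.congr fun m => ?_
  simp only [gram_eq_regr, regr_add, transpose_add, Matrix.add_mul, Matrix.mul_add, Matrix.smul_mul,
    smul_add, smul_sub]
  abel

end GramLimits

/-! ### Averages over the first rows -/

section FirstRows

variable {κ ν : Type*}

theorem firstRows_transpose_mul_apply (N : ℕ) (u : ℕ → κ → ℝ) (v : ℕ → ν → ℝ) (a : κ) (b : ν) :
    ((firstRows N u)ᵀ * firstRows N v) a b = ∑ i ∈ Finset.range N, u i a * v i b := by
  rw [Matrix.mul_apply, ← Fin.sum_univ_eq_sum_range (fun i => u i a * v i b)]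
  rfl

/-- Averages over `m - j` rows may be normalized by `m`, as `(m - j) / m → 1`. -/
theorem tendsto_average_sub {s : ℕ → ℝ} {L : ℝ} (j : ℕ)
    (h : Tendsto (fun n : ℕ => (n : ℝ)⁻¹ * s n) atTop (𝓝 L)) :
    Tendsto (fun m : ℕ => (m : ℝ)⁻¹ * s (m - j)) atTop (𝓝 L) := by
  have h1 := h.comp (tendsto_sub_atTop_nat j)
  have h2 : Tendsto (fun m : ℕ => 1 - (j : ℝ) * (m : ℝ)⁻¹) atTop (𝓝 1) := by
    simpa using (tendsto_const_nhds (x := (1 : ℝ))).sub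
      (tendsto_inv_atTop_nhds_zero_nat.const_mul (j : ℝ))
  have h3 := h2.mul h1
  rw [one_mul] at h3
  refine h3.congr' ?_
  filter_upwards [eventually_gt_atTop j] with m hm
  have hm0 : (m : ℝ) ≠ 0 := Nat.cast_ne_zero.2 (by omega)
  have hmj : (m : ℝ) - j ≠ 0 := sub_ne_zero.2 (Nat.cast_injective.ne hm.ne')
  simp only [Function.comp_apply, Nat.cast_sub hm.le]
  field_simp

theorem tendsto_firstRows {u : ℕ → κ → ℝ} {v : ℕ → ν → ℝ} {L : Matrix κ ν ℝ} (j : ℕ)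
    (h : ∀ a b, Tendsto (fun n : ℕ => (n : ℝ)⁻¹ * ∑ i ∈ Finset.range n, u i a * v i b) atTop
      (𝓝 (L a b))) :
    Tendsto (fun m : ℕ => (m : ℝ)⁻¹ • ((firstRows (m - j) u)ᵀ * firstRows (m - j) v)) atTop
      (𝓝 L) := by
  rw [tendsto_matrix]
  intro a b
  refine (tendsto_average_sub j (h a b)).congr fun m => ?_
  rw [Matrix.smul_apply, firstRows_transpose_mul_apply, smul_eq_mul]

theorem exists_sum_sq_le {u : ℕ → κ → ℝ} {L : Matrix κ κ ℝ} {j : ℕ}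
    (h : Tendsto (fun m : ℕ => (m : ℝ)⁻¹ • ((firstRows (m - j) u)ᵀ * firstRows (m - j) u)) atTop
      (𝓝 L)) (a : κ) : ∃ K : ℝ, ∀ n : ℕ, ∑ i ∈ Finset.range n, u i a ^ 2 ≤ K * n := by
  obtain ⟨K, hK⟩ := (tendsto_matrix.1 h a a).bddAbove_range
  -- The bound is read off at `m = n + j`; the factor comes from `n + j ≤ (1 + j) n` for `n ≥ 1`.
  refine ⟨max K 0 * (1 + j), fun n => ?_⟩
  rcases Nat.eq_zero_or_pos n with rfl | hn
  · simp
  · have h1 := hK ⟨n + j, rfl⟩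
    simp only [Matrix.smul_apply, firstRows_transpose_mul_apply, smul_eq_mul,
      Nat.add_sub_cancel, ← sq] at h1
    have hpos : (0 : ℝ) < (n + j : ℕ) := by positivity
    rw [inv_mul_le_iff₀ hpos] at h1
    have h2 : (1 : ℝ) ≤ n := Nat.one_le_cast.2 hn
    have h3 : ((n + j : ℕ) : ℝ) ≤ (1 + j) * n := by
      push_cast
      nlinarith [(Nat.cast_nonneg j : (0 : ℝ) ≤ j)]
    calc _ ≤ ((n + j : ℕ) : ℝ) * K := h1
      _ ≤ (n + j : ℕ) * max K 0 := by gcongr; exact le_max_left _ _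
      _ ≤ ((1 + j) * n) * max K 0 := by gcongr
      _ = _ := by ring

theorem ErrorAssumption.ae_tendsto_cross {Ω : Type*} [MeasurableSpace Ω] [Countable κ] [Countable ν]
    [DecidableEq ν] {μ : Measure Ω} [IsProbabilityMeasure μ] {E : ℕ → Ω → ν → ℝ} {σ : ℝ}
    (hE : ErrorAssumption μ E σ) {u : ℕ → κ → ℝ} {L : Matrix κ κ ℝ} {j : ℕ}
    (h : Tendsto (fun m : ℕ => (m : ℝ)⁻¹ • ((firstRows (m - j) u)ᵀ * firstRows (m - j) u)) atTop
      (𝓝 L)) :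
    ∀ᵐ ω ∂μ, Tendsto (fun m : ℕ => (m : ℝ)⁻¹ •
      ((firstRows (m - j) u)ᵀ * firstRows (m - j) fun i => E i ω)) atTop (𝓝 0) := by
  have h1 : ∀ a b, ∀ᵐ ω ∂μ, Tendsto (fun n : ℕ => (n : ℝ)⁻¹ *
      ∑ i ∈ Finset.range n, u i a * E i ω b) atTop (𝓝 0) := fun a b => by
    obtain ⟨K, hK⟩ := exists_sum_sq_le h a
    exact hE.ae_tendsto_average_mul hK b
  filter_upwards [ae_all_iff.2 fun a => ae_all_iff.2 (h1 a)] with ω hω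
  exact tendsto_firstRows j hω

theorem ErrorAssumption.ae_tendsto_gram {Ω : Type*} [MeasurableSpace Ω] [Countable ν]
    [DecidableEq ν] {μ : Measure Ω} [IsProbabilityMeasure μ] {E : ℕ → Ω → ν → ℝ} {σ : ℝ}
    (hE : ErrorAssumption μ E σ) (j : ℕ) :
    ∀ᵐ ω ∂μ, Tendsto (fun m : ℕ => (m : ℝ)⁻¹ •
      ((firstRows (m - j) fun i => E i ω)ᵀ * firstRows (m - j) fun i => E i ω)) atTop
      (𝓝 (σ ^ 2 • 1)) := by
  filter_upwards [ae_all_iff.2 fun a => ae_all_iff.2 (hE.ae_tendsto_average_mul_self a)] with ω hω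
  exact tendsto_firstRows j hω

end FirstRows

/-- An orthonormal family of `N - rank C` vectors in the null space of `C` spans it. -/
theorem mul_transpose_mul_of_null {ρ ν lam : Type*} [Fintype ρ] [Fintype ν] [DecidableEq ν] {N : ℕ}
    {C : Matrix ρ ν ℝ} {P : Matrix ν (Fin N) ℝ} (hN : C.rank + N = Fintype.card ν)
    (hP : Pᵀ * P = 1) (hCP : C * P = 0) {V : Matrix ν lam ℝ} (hV : C * V = 0) :
    P * (Pᵀ * V) = V := by
  have hle : LinearMap.range P.mulVecLin ≤ LinearMap.ker C.mulVecLin := by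
    rintro _ ⟨x, rfl⟩
    rw [LinearMap.mem_ker, mulVecLin_apply, mulVecLin_apply, mulVec_mulVec, hCP, zero_mulVec]
  have hrank : P.rank = N := by
    have h1 := rank_mul_le_right Pᵀ P
    rw [hP, rank_one, Fintype.card_fin] at h1
    exact le_antisymm (by simpa using rank_le_card_width P) h1
  have heq : LinearMap.range P.mulVecLin = LinearMap.ker C.mulVecLin := by
    refine Submodule.eq_of_le_of_finrank_eq hle ?_
    have h1 := C.mulVecLin.finrank_range_add_finrank_ker
    rw [Module.finrank_fintype_fun_eq_card] at h1
    change C.rank + _ = _ at h1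
    change P.rank = _
    omega
  ext i c
  have hmem : V.col c ∈ LinearMap.ker C.mulVecLin := by
    rw [LinearMap.mem_ker, mulVecLin_apply]
    ext a
    exact congrFun (congrFun hV a) c
  rw [← heq] at hmem
  obtain ⟨y, hy⟩ := hmem
  have h1 : P *ᵥ (Pᵀ *ᵥ V.col c) = V.col c := by
    rw [← hy, mulVecLin_apply, mulVec_mulVec (M := Pᵀ), hP, one_mulVec]
  exact congrFun h1 i

theorem fromCols_firstRows {κ ν : Type*} (N : ℕ) (u : ℕ → κ → ℝ) (v : ℕ → ν → ℝ) :
    fromCols (firstRows N u) (firstRows N v) = firstRows N fun i => Sum.elim (u i) (v i) := by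
  ext i (c | c) <;> rfl

theorem firstRows_mul {κ ν : Type*} [Fintype κ] (N : ℕ) (u : ℕ → κ → ℝ) (P : Matrix κ ν ℝ) :
    firstRows N u * P = firstRows N fun i => u i ᵥ* P := rfl

/-! ### Consistency for one realization -/

section Deterministic

variable {j k q l d : ℕ} {A₁₂ : Matrix (Fin j) (Fin q) ℝ} {B₁ : Matrix (Fin j) (Fin l) ℝ}
  {X : Matrix (Fin k ⊕ Fin q) (Fin l) ℝ} {P : Matrix (Fin q ⊕ Fin l) (Fin (l + d)) ℝ}
  {A : (m : ℕ) → Matrix (Fin (m - j)) (Fin k) ℝ}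
  {A₂₂ : (m : ℕ) → Matrix (Fin (m - j)) (Fin q) ℝ}
  {B₂ : (m : ℕ) → Matrix (Fin (m - j)) (Fin l) ℝ}
  {S₁₁ : Matrix (Fin k) (Fin k) ℝ} {S₁₂ : Matrix (Fin k) (Fin q ⊕ Fin l) ℝ}
  {T : Matrix (Fin (l + d)) (Fin (l + d)) ℝ} {s : ℝ}

/-- Consistency for a single realization of the errors, for which the averages converge. -/
theorem consistency_of_tendsto (hP : Pᵀ * P = 1) (hCP : fromCols A₁₂ B₁ * P = 0)
    (hnull : ∀ Y : Matrix (Fin q) (Fin l) ℝ, A₁₂ * Y = B₁ → P * (Pᵀ * negAug Y) = negAug Y)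
    (hX : A₁₂ * X.toRows₂ = B₁) (hS : IsUnit S₁₁)
    (hA : Tendsto (fun m : ℕ => (m : ℝ)⁻¹ • ((A m)ᵀ * A m)) atTop (𝓝 S₁₁))
    (hC : Tendsto (fun m : ℕ => (m : ℝ)⁻¹ • ((A m)ᵀ * fromCols (A₂₂ m) (B₂ m))) atTop (𝓝 S₁₂))
    (hSX : S₁₁ * X.toRows₁ + S₁₂ * negAug X.toRows₂ = 0)
    (hG : Tendsto (fun m : ℕ => (m : ℝ)⁻¹ • (Pᵀ * gram (A m) (fromCols (A₂₂ m) (B₂ m)) * P)) atTop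
      (𝓝 (T + s • 1)))
    (hT : Tᵀ = T) (hTpos : ∀ v, 0 ≤ v ⬝ᵥ T *ᵥ v) (hTrank : T.rank = d)
    (hTX : T * (Pᵀ * negAug X.toRows₂) = 0) :
    (∀ᶠ m in atTop, ∃! X' : Matrix (Fin k ⊕ Fin q) (Fin l) ℝ,
      IsSolution 0 A₁₂ (A m) (A₂₂ m) B₁ (B₂ m) X') ∧
    (∀ᶠ m in atTop, ∀ X' : Matrix (Fin k ⊕ Fin q) (Fin l) ℝ,
      IsSolution 0 A₁₂ (A m) (A₂₂ m) B₁ (B₂ m) X' →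
      (∀ Z : Matrix (Fin q ⊕ Fin l) (Fin l) ℝ,
        IsRitzMatrix (gram (A m) (fromCols (A₂₂ m) (B₂ m))) P Z →
          IsUnit Z.toRows₂ ∧ X'.toRows₂ = -(Z.toRows₁ * Z.toRows₂⁻¹)) ∧
      IsUnit ((A m)ᵀ * A m) ∧
      (A m)ᵀ * A m * X'.toRows₁ + (A m)ᵀ * fromCols (A₂₂ m) (B₂ m) * negAug X'.toRows₂ = 0) ∧
    ∀ Xc : ℕ → Matrix (Fin k ⊕ Fin q) (Fin l) ℝ,
      (∀ᶠ m in atTop, IsSolution 0 A₁₂ (A m) (A₂₂ m) B₁ (B₂ m) (Xc m)) →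
        Tendsto Xc atTop (𝓝 X) := by
  set C : (m : ℕ) → Matrix (Fin (m - j)) (Fin q ⊕ Fin l) ℝ := fun m => fromCols (A₂₂ m) (B₂ m)
    with hCdef
  set M : ℕ → Matrix (Fin (l + d)) (Fin (l + d)) ℝ := fun m => Pᵀ * gram (A m) (C m) * P with hM
  obtain ⟨W₀, θ₀, h₀⟩ := exists_isEigenDecomposition hT
  have hθ₀ : ∀ i, 0 ≤ θ₀ i := by
    intro i
    have h1 : W₀ᵀ * T * W₀ = diagonal θ₀ := by
      rw [Matrix.mul_assoc, h₀.eigen, ← Matrix.mul_assoc, h₀.orthogonal, Matrix.one_mul]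
    have h2 : (W₀ᵀ * T * W₀) i i = (W₀.col i) ⬝ᵥ T *ᵥ (W₀.col i) := by
      rw [Matrix.mul_assoc]
      rfl
    rw [← diagonal_apply_eq θ₀ i, ← h1, h2]
    exact hTpos _
  obtain ⟨hlow, δ, hδ, hhigh⟩ := h₀.of_rank hTrank hθ₀
  -- Removing the noise shift `s` leaves the eigenvectors unchanged and makes the low eigenvalues of
  -- the limit zero; `hdec` later restores shift and scale.
  set t : ℕ → Matrix (Fin (l + d)) (Fin (l + d)) ℝ := fun m => (m : ℝ)⁻¹ • M m - s • 1 with ht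
  have htlim : Tendsto t atTop (𝓝 T) := by
    have := hG.sub (tendsto_const_nhds (x := s • (1 : Matrix (Fin (l + d)) (Fin (l + d)) ℝ)))
    rwa [add_sub_cancel_right] at this
  have htsymm : ∀ m, (t m)ᵀ = t m := fun m => by
    simp only [ht, hM, transpose_sub, transpose_smul, transpose_mul, transpose_transpose,
      gram_transpose, transpose_one, Matrix.mul_assoc]
  choose W η hW using fun m => exists_isEigenDecomposition (htsymm m)
  have hproj := tendsto_lowProj h₀ hlow hδ hhigh htlim hW
  have hgap := eventually_gap h₀ hlow hδ hhigh htlim hW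
  obtain ⟨hZ₀, hX₂⟩ := quotient_eq_of_null h₀ (fun i => hδ.trans_le (hhigh i)) (hnull _ hX) hTX hT
  obtain ⟨hZ, hquot⟩ := tendsto_quotient hproj hZ₀
  have hAu := eventually_isUnit_transpose_mul_self hA hS
  have hdec : ∀ᶠ m : ℕ in atTop, IsEigenDecomposition (M m) (W m) fun i => m * (η m i + s) := by
    filter_upwards [eventually_gt_atTop 0] with m hm
    have hm' : (0 : ℝ) < m := Nat.cast_pos.2 hm
    refine ⟨fun i i' hi => ?_, (hW m).orthogonal, ?_⟩
    · have := (hW m).monotone hi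
      gcongr
    · have h1 : M m = (m : ℝ) • (t m + s • 1) := by
        rw [ht, sub_add_cancel, smul_smul, mul_inv_cancel₀ hm'.ne', one_smul]
      have h2 : (diagonal fun i => (m : ℝ) * (η m i + s)) = (m : ℝ) • (diagonal (η m) + s • 1) := by
        rw [← diagonal_one, ← diagonal_smul, diagonal_add, ← diagonal_smul]
        congr 1
        ext i
        simp
      rw [h1, h2, Matrix.smul_mul, Matrix.add_mul, (hW m).eigen, Matrix.smul_mul, Matrix.one_mul,
        Matrix.mul_smul, Matrix.mul_add, Matrix.mul_smul, Matrix.mul_one]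
  have hsol : ∀ᶠ m in atTop, ∀ X' : Matrix (Fin k ⊕ Fin q) (Fin l) ℝ,
      IsSolution 0 A₁₂ (A m) (A₂₂ m) B₁ (B₂ m) X' ↔
        X'.toRows₂ = -((P * lowCols d (W m)).toRows₁ * (P * lowCols d (W m)).toRows₂⁻¹) ∧
        X'.toRows₁ = -(regr (A m) (C m) * negAug X'.toRows₂) := by
    filter_upwards [hgap, hZ, hAu, hdec, eventually_gt_atTop 0] with m hg hZ hAu hdec hm X'
    have hm' : (0 : ℝ) < m := Nat.cast_pos.2 hm
    exact isSolution_iff hP hCP hnull hAu hdec (a := m * (δ / 3 + s)) (b := m * (2 * δ / 3 + s))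
      (by gcongr; linarith) (fun i => by have := hg.1 i; gcongr)
      (fun i => by have := hg.2 i; gcongr) hZ X'
  refine ⟨?_, ?_, ?_⟩
  · filter_upwards [hsol] with m hsol
    set Y := -((P * lowCols d (W m)).toRows₁ * (P * lowCols d (W m)).toRows₂⁻¹) with hY
    refine ⟨fromRows (-(regr (A m) (C m) * negAug Y)) Y, ?_, fun X' hX' => ?_⟩
    · exact (hsol _).2 ⟨rfl, rfl⟩
    · obtain ⟨h2, h1⟩ := (hsol _).1 hX'
      rw [← fromRows_toRows X', h1, h2]
  · filter_upwards [hsol, hgap, hZ, hAu, hdec, eventually_gt_atTop 0]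
      with m hsol hg hZ hAu hdec hm X' hX'
    have hm' : (0 : ℝ) < m := Nat.cast_pos.2 hm
    obtain ⟨h2, h1⟩ := (hsol _).1 hX'
    refine ⟨fun Z hRitz => ?_, hAu, ?_⟩
    · obtain ⟨hu, hq⟩ := hRitz.quotient_eq hdec (a := m * (δ / 3 + s)) (b := m * (2 * δ / 3 + s))
        (by gcongr; linarith) (fun i => by have := hg.1 i; gcongr)
        (fun i => by have := hg.2 i; gcongr) hZ
      exact ⟨hu, by rw [h2, hq]⟩
    · rw [h1, Matrix.mul_neg, ← Matrix.mul_assoc, transpose_mul_regr hAu, neg_add_cancel]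
  · intro Xc hXc
    have h2 : Tendsto (fun m => (Xc m).toRows₂) atTop (𝓝 X.toRows₂) := by
      rw [hX₂]
      refine hquot.neg.congr' ?_
      filter_upwards [hXc, hsol] with m hm hsol
      exact ((hsol _).1 hm).1.symm
    have hV : Tendsto (fun m => negAug (Xc m).toRows₂) atTop (𝓝 (negAug X.toRows₂)) := by
      rw [tendsto_matrix] at h2 ⊢
      rintro (i | i) c
      · exact h2 i c
      · exact tendsto_const_nhds
    have h1 : Tendsto (fun m => (Xc m).toRows₁) atTop (𝓝 X.toRows₁) := by
      have h3 : X.toRows₁ = -(S₁₁⁻¹ * S₁₂ * negAug X.toRows₂) := by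
        rw [← Matrix.one_mul X.toRows₁, ← nonsing_inv_mul _ ((isUnit_iff_isUnit_det _).1 hS),
          Matrix.mul_assoc, eq_neg_of_add_eq_zero_left hSX, Matrix.mul_neg, Matrix.mul_assoc]
      rw [h3]
      refine (tendsto_matrix_mul (tendsto_regr hA hS hC) hV).neg.congr' ?_
      filter_upwards [hXc, hsol] with m hm hsol
      exact ((hsol _).1 hm).2.symm
    rw [tendsto_matrix] at h1 h2 ⊢
    rintro (i | i) c
    · exact h1 i c
    · exact h2 i c

end Deterministic

end CTLS

/-! ### The main theorem -/

/-- Strong consistency of the constrained total least squares solution. Here `j` is the number of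
fixed rows, `k` the number of fixed columns, `q = n - k`, and `m` the total number of rows, of
which the last `m - j` are the first `m - j` terms of the sequences `a₂₁`, `a₂₂`, `b₂`, `E`. -/
theorem mainTheorem2
    {Ω : Type*} [MeasurableSpace Ω] (μ : Measure Ω) [IsProbabilityMeasure μ]
    (j k q l : ℕ)
    -- true parameters: fixed upper rows `[0 A₁₂] X = B₁`, lower rows `[a₂₁ a₂₂] X = b₂`
    (A₁₂ : Matrix (Fin j) (Fin q) ℝ) (B₁ : Matrix (Fin j) (Fin l) ℝ)
    (a₂₁ : ℕ → Fin k → ℝ) (a₂₂ : ℕ → Fin q → ℝ) (b₂ : ℕ → Fin l → ℝ)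
    (X : Matrix (Fin k ⊕ Fin q) (Fin l) ℝ)
    (hX : ∀ m : ℕ,
      fromBlocks 0 A₁₂ (CTLS.firstRows (m - j) a₂₁) (CTLS.firstRows (m - j) a₂₂) * X
        = fromRows B₁ (CTLS.firstRows (m - j) b₂))
    (hrank : (fromCols A₁₂ B₁).rank = j)
    -- an orthonormal basis of the null space of `[A₁₂ B₁]`
    (P : Matrix (Fin q ⊕ Fin l) (Fin (l + (q - j))) ℝ)
    (hP : Pᵀ * P = 1) (hCP : fromCols A₁₂ B₁ * P = 0)
    -- errors in the lower right block `[A₂₂ B₂]`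
    (E : ℕ → Ω → Fin q ⊕ Fin l → ℝ) (σ : ℝ)
    (hE : CTLS.ErrorAssumption μ E σ)
    (hPGP : CTLS.AsymptoticAssumption j a₂₁ (fun i => Sum.elim (a₂₂ i) (b₂ i)) P (q - j)) :
    ∀ᵐ ω ∂μ,
      -- the observed blocks for `m` rows in total
      let A₂₁ : (m : ℕ) → Matrix (Fin (m - j)) (Fin k) ℝ := fun m => CTLS.firstRows (m - j) a₂₁
      let A₂₂ : (m : ℕ) → Matrix (Fin (m - j)) (Fin q) ℝ := fun m =>
        CTLS.firstRows (m - j) fun i c => a₂₂ i c + E i ω (Sum.inl c)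
      let B₂ : (m : ℕ) → Matrix (Fin (m - j)) (Fin l) ℝ := fun m =>
        CTLS.firstRows (m - j) fun i c => b₂ i c + E i ω (Sum.inr c)
      let C₂₂ : (m : ℕ) → Matrix (Fin (m - j)) (Fin q ⊕ Fin l) ℝ := fun m =>
        fromCols (A₂₂ m) (B₂ m)
      let IsXctls : ℕ → Matrix (Fin k ⊕ Fin q) (Fin l) ℝ → Prop := fun m =>
        CTLS.IsSolution 0 A₁₂ (A₂₁ m) (A₂₂ m) B₁ (B₂ m)
      -- for all large `m` there is exactly one solution
      (∀ᶠ m in atTop, ∃! X' : Matrix (Fin k ⊕ Fin q) (Fin l) ℝ, IsXctls m X') ∧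
      -- it is given by Ritz vectors (lower part) and the normal equations (upper part)
      (∀ᶠ m in atTop, ∀ X' : Matrix (Fin k ⊕ Fin q) (Fin l) ℝ, IsXctls m X' →
        (∀ Z : Matrix (Fin q ⊕ Fin l) (Fin l) ℝ,
          CTLS.IsRitzMatrix (CTLS.gram (A₂₁ m) (C₂₂ m)) P Z →
            IsUnit Z.toRows₂ ∧ X'.toRows₂ = -(Z.toRows₁ * Z.toRows₂⁻¹)) ∧
        IsUnit ((A₂₁ m)ᵀ * A₂₁ m) ∧
        (A₂₁ m)ᵀ * A₂₁ m * X'.toRows₁ + (A₂₁ m)ᵀ * C₂₂ m * fromRows X'.toRows₂ (-1) = 0) ∧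
      -- and it converges to `X`
      ∀ Xctls : ℕ → Matrix (Fin k ⊕ Fin q) (Fin l) ℝ,
        (∀ᶠ m in atTop, IsXctls m (Xctls m)) → Tendsto Xctls atTop (𝓝 X) := by
  set c₂₂ : ℕ → Fin q ⊕ Fin l → ℝ := fun i => Sum.elim (a₂₂ i) (b₂ i) with hc
  obtain ⟨⟨S₁₁, S₁₂, hSpos, hSlim⟩, T, hTrank, hTlim⟩ := hPGP
  have hS : IsUnit S₁₁ := hSpos.isUnit
  -- the true equations
  have hX' : ∀ m : ℕ, A₁₂ * X.toRows₂ = B₁ ∧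
      CTLS.firstRows (m - j) a₂₁ * X.toRows₁ +
        CTLS.firstRows (m - j) c₂₂ * CTLS.negAug X.toRows₂ = 0 := fun m => by
    have h := hX m
    rw [← fromRows_toRows X, fromBlocks_mul_fromRows, Matrix.zero_mul, zero_add,
      fromRows_ext_iff] at h
    refine ⟨h.1, ?_⟩
    rw [hc, ← CTLS.fromCols_firstRows, CTLS.mul_negAug, ← add_sub_assoc, h.2, sub_self]
  have hXB : A₁₂ * X.toRows₂ = B₁ := (hX' 0).1
  -- The columns of `B₁` are combinations of those of `A₁₂`, so the rank `j` is at most `q`. Hence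
  -- the truncated `q - j` is a true difference, and `P` has the full dimension of the null space.
  have hjq : j ≤ q := by
    have h1 : fromCols A₁₂ B₁ = A₁₂ * fromCols (1 : Matrix (Fin q) (Fin q) ℝ) X.toRows₂ := by
      rw [mul_fromCols, Matrix.mul_one, hXB]
    have h2 := (rank_mul_le_left A₁₂ (fromCols (1 : Matrix (Fin q) (Fin q) ℝ) X.toRows₂)).trans (rank_le_card_width A₁₂)
    rwa [← h1, hrank, Fintype.card_fin] at h2
  have hnull : ∀ Y : Matrix (Fin q) (Fin l) ℝ, A₁₂ * Y = B₁ →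
      P * (Pᵀ * CTLS.negAug Y) = CTLS.negAug Y := fun Y hY => by
    refine CTLS.mul_transpose_mul_of_null ?_ hP hCP ?_
    · rw [hrank, Fintype.card_sum, Fintype.card_fin, Fintype.card_fin]
      omega
    · rw [CTLS.mul_negAug, hY, sub_self]
  -- limits of the true moments
  have hA : Tendsto (fun m : ℕ => (m : ℝ)⁻¹ •
      ((CTLS.firstRows (m - j) a₂₁)ᵀ * CTLS.firstRows (m - j) a₂₁)) atTop (𝓝 S₁₁) :=
    CTLS.tendsto_matrix.2 fun a b => CTLS.tendsto_matrix.1 hSlim a (Sum.inl b)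
  have hAc : Tendsto (fun m : ℕ => (m : ℝ)⁻¹ •
      ((CTLS.firstRows (m - j) a₂₁)ᵀ * CTLS.firstRows (m - j) c₂₂)) atTop (𝓝 S₁₂) :=
    CTLS.tendsto_matrix.2 fun a b => CTLS.tendsto_matrix.1 hSlim a (Sum.inr b)
  have hAu := CTLS.eventually_isUnit_transpose_mul_self hA hS
  have hAcP : Tendsto (fun m : ℕ => (m : ℝ)⁻¹ •
      ((CTLS.firstRows (m - j) a₂₁)ᵀ * (CTLS.firstRows (m - j) c₂₂ * P))) atTop (𝓝 (S₁₂ * P)) :=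
    (CTLS.tendsto_matrix_mul hAc tendsto_const_nhds).congr fun m => by
      rw [Matrix.smul_mul, Matrix.mul_assoc]
  have hGc : Tendsto (fun m : ℕ => (m : ℝ)⁻¹ • CTLS.gram (CTLS.firstRows (m - j) a₂₁)
      (CTLS.firstRows (m - j) c₂₂ * P)) atTop (𝓝 T) := by
    simpa only [CTLS.gram_mul] using hTlim
  -- Only `C₂₂ P`, not `C₂₂`, is known to have convergent second moments, so the strong law is
  -- applied to the rows of `C₂₂ P`.
  have hcc := CTLS.tendsto_transpose_mul_self_of_gram hA hS hAcP hGc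
  have hSX : S₁₁ * X.toRows₁ + S₁₂ * CTLS.negAug X.toRows₂ = 0 := by
    refine tendsto_nhds_unique ((CTLS.tendsto_matrix_mul hA tendsto_const_nhds).add
      (CTLS.tendsto_matrix_mul hAc tendsto_const_nhds)) (tendsto_const_nhds.congr fun m => ?_)
    rw [Matrix.smul_mul, Matrix.smul_mul, Matrix.mul_assoc, Matrix.mul_assoc, ← smul_add,
      ← Matrix.mul_add, (hX' m).2, Matrix.mul_zero, smul_zero]
  have hTsymm : Tᵀ = T := by
    refine tendsto_nhds_unique (CTLS.tendsto_matrix_transpose hGc) (hGc.congr fun m => ?_)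
    rw [transpose_smul, CTLS.gram_transpose]
  have hTpos : ∀ v, 0 ≤ v ⬝ᵥ T *ᵥ v := by
    intro v
    have hlim : Tendsto (fun m : ℕ => v ⬝ᵥ ((m : ℝ)⁻¹ • CTLS.gram (CTLS.firstRows (m - j) a₂₁)
        (CTLS.firstRows (m - j) c₂₂ * P)) *ᵥ v) atTop (𝓝 (v ⬝ᵥ T *ᵥ v)) :=
      ((continuous_const.dotProduct (continuous_id.matrix_mulVec continuous_const)).tendsto T).comp
        hGc
    refine ge_of_tendsto hlim ?_
    filter_upwards [hAu] with m hm
    rw [CTLS.gram_eq hm, smul_mulVec, dotProduct_smul, ← mulVec_mulVec, dotProduct_mulVec,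
      vecMul_transpose]
    exact smul_nonneg (by positivity) (Finset.sum_nonneg fun i _ => mul_self_nonneg _)
  -- By the exact equations `C₂₂ V = -A₂₁ X₁` for `V = negAug X.toRows₂`, which regression on `A₂₁`
  -- removes completely.
  have hTX : T * (Pᵀ * CTLS.negAug X.toRows₂) = 0 := by
    refine tendsto_nhds_unique (CTLS.tendsto_matrix_mul hTlim tendsto_const_nhds)
      (tendsto_const_nhds.congr' ?_)
    filter_upwards [hAu] with m hm
    have h1 : CTLS.firstRows (m - j) c₂₂ * CTLS.negAug X.toRows₂
        = CTLS.firstRows (m - j) a₂₁ * -X.toRows₁ := by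
      rw [Matrix.mul_neg]
      exact eq_neg_of_add_eq_zero_right (hX' m).2
    have h2 : CTLS.gram (CTLS.firstRows (m - j) a₂₁) (CTLS.firstRows (m - j) c₂₂)
        * CTLS.negAug X.toRows₂ = 0 := by
      rw [CTLS.gram_eq_regr, Matrix.sub_mul, Matrix.mul_assoc, Matrix.mul_assoc, h1,
        ← CTLS.regr_mul, h1, CTLS.regr_mul, CTLS.regr, nonsing_inv_mul _
        ((isUnit_iff_isUnit_det _).1 hm), Matrix.one_mul, Matrix.mul_assoc, sub_self]
    rw [Matrix.smul_mul, Matrix.mul_assoc _ P, hnull _ hXB, Matrix.mul_assoc, h2,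
      Matrix.mul_zero, smul_zero]
  simp only [CTLS.firstRows_mul] at hcc
  filter_upwards [hE.ae_tendsto_cross hA, hE.ae_tendsto_cross hcc, hE.ae_tendsto_gram j]
    with ω hAE hcE hEE
  have hobs : ∀ m : ℕ, fromCols (CTLS.firstRows (m - j) fun i c => a₂₂ i c + E i ω (Sum.inl c))
      (CTLS.firstRows (m - j) fun i c => b₂ i c + E i ω (Sum.inr c))
      = CTLS.firstRows (m - j) c₂₂ + CTLS.firstRows (m - j) fun i => E i ω := fun m => by
    ext i (c | c) <;> rfl
  refine CTLS.consistency_of_tendsto (s := σ ^ 2) hP hCP hnull hXB hS hA (S₁₂ := S₁₂) ?_ hSX ?_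
    hTsymm hTpos hTrank hTX
  · have h := hAc.add hAE
    rw [add_zero] at h
    refine h.congr fun m => ?_
    rw [hobs, Matrix.mul_add, smul_add]
  · have hAe := CTLS.tendsto_matrix_mul hAE (tendsto_const_nhds (x := P))
    have hce := CTLS.tendsto_matrix_mul hcE (tendsto_const_nhds (x := P))
    have hee := CTLS.tendsto_matrix_mul (CTLS.tendsto_matrix_mul
      (tendsto_const_nhds (x := Pᵀ)) hEE) (tendsto_const_nhds (x := P))
    rw [Matrix.zero_mul] at hAe hce
    rw [Matrix.mul_smul, Matrix.mul_one, Matrix.smul_mul, hP] at hee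
    have h := CTLS.tendsto_gram_add hA hS hAcP hGc
      (e := fun m => (CTLS.firstRows (m - j) fun i => E i ω) * P)
      (hAe.congr fun m => by rw [Matrix.smul_mul, Matrix.mul_assoc])
      (hce.congr fun m => by rw [Matrix.smul_mul, Matrix.mul_assoc, CTLS.firstRows_mul _ c₂₂])
      (hee.congr fun m => by
        simp only [Matrix.smul_mul, Matrix.mul_smul, Matrix.mul_assoc, transpose_mul])
    refine h.congr fun m => ?_
    rw [hobs, ← Matrix.add_mul, CTLS.gram_mul]
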